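/- Let $d\ge 2$, let $\xi^+\neq\xi^-$ be points of the unit sphere $\mathbb S^{d-1}\subset\mathbb R^d$, let $V_{\min}>0$ and $\alpha\in(0,2)$. Let $V\in\mathcal C^2(\mathbb S^{d-1})$ satisfy $V(s)\ge V(\xi^\pm)=V_{\min}$ for every $s\in\mathbb S^{d-1}$, and suppose that there are $\delta,\mu>0$ such that $V(s)-V(\xi^\pm)\ge\mu|s-\xi^\pm|^2$ whenever $|s-\xi^\pm|<\delta$. Extend $V$ to $\mathbb R^d\setminus\{0\}$ by $V(x)=V(x/|x|)/|x|^\alpha$, and put $V(0)=+\infty$. For $a<b$ and $x\in H^1((a,b);\mathbb R^d)$ (identified with its continuous representative on $[a,b]$) let \[ \mathcal A([a,b];x)=\int_a^b\Big(\tfrac12|\dot x(t)|^2+V(x(t))\Big)\,dt\in[0,+\infty], \] and let \[ c(V)=\inf\{\mathcal A([a,b];x): a<b,\ x\in H^1((a,b);\mathbb R^d),\ x(a)=\xi^-,\ x(b)=\xi^+\}. \] Then this infimum is attained, and exactly one of the following two alternatives holds. (1) $c(V)=4\sqrt{2V_{\min}}/(2-\alpha)$, and it is attained by a juxtaposition of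 two homothetic motions, the first from $\xi^-$ to the origin and the second from the origin to $\xi^+$; that is, by a path $x$ on some $[a,b]$ for which there is $\tau\in(a,b)$ with $x(\tau)=0$, $x(t)=|x(t)|\,\xi^-$ on $[a,\tau]$, $x(t)=|x(t)|\,\xi^+$ on $[\tau,b]$, and such that $x\ne0$ and $\ddot x=\nabla V(x)$ on $(a,\tau)\cup(\tau,b)$. (2) $c(V)<4\sqrt{2V_{\min}}/(2-\alpha)$, and there is $\rho>0$ such that every minimizer, that is, every admissible $x$ on an interval $[a,b]$ with $\mathcal A([a,b];x)=c(V)$, satisfies $|x(t)|\ge\rho$ for all $t\in[a,b]$ and is a classical solution of $\ddot x=\nabla V(x)$ on $(a,b)$. -/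

import Mathlib

open scoped Manifold ContDiff ENNReal

noncomputable section

namespace AnisotropicKepler

/-- The ambient space `ℝ^d` with `d = n + 1`, with its Euclidean norm. -/
abbrev Space (n : ℕ) : Type := EuclideanSpace ℝ (Fin (n + 1))

/-- The unit sphere `S^{d-1} = S^n` of `ℝ^d`. -/
abbrev UnitSphere (n : ℕ) : Type := Metric.sphere (0 : Space n) 1

/-- The radial projection `x ↦ x / |x|` of `ℝ^d \ {0}` onto the unit sphere. -/
def direction {n : ℕ} (x : Space n) (hx : x ≠ 0) : UnitSphere n :=
  ⟨‖x‖⁻¹ • x, by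
    rw [mem_sphere_zero_iff_norm, norm_smul, norm_inv, norm_norm]
    exact inv_mul_cancel₀ (norm_ne_zero_iff.mpr hx)⟩

/-- The class `𝒮`: functions of class `C²` on the sphere, with global minimum value `Vmin` attained
at both `ξm` (that is, `ξ⁻`) and `ξp` (that is, `ξ⁺`), both minima being non-degenerate. -/
structure ClassS {n : ℕ} (ξm ξp : UnitSphere n) (Vmin : ℝ) (U : UnitSphere n → ℝ) : Prop where
  contMDiff : ContMDiff (𝓡 n) 𝓘(ℝ, ℝ) 2 U
  eq_left : U ξm = Vmin
  eq_right : U ξp = Vmin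
  min_le : ∀ s, Vmin ≤ U s
  nondegenerate : ∃ δ > 0, ∃ μ > 0, ∀ s : UnitSphere n,
    (‖(s : Space n) - ξm‖ < δ → μ * ‖(s : Space n) - ξm‖ ^ 2 ≤ U s - U ξm) ∧
    (‖(s : Space n) - ξp‖ < δ → μ * ‖(s : Space n) - ξp‖ ^ 2 ≤ U s - U ξp)

/-- The class `𝒫` of pairs `(U, α)` with `U ∈ 𝒮` and `α ∈ (0, 2)`. -/
def classP {n : ℕ} (ξm ξp : UnitSphere n) (Vmin : ℝ) : Set ((UnitSphere n → ℝ) × ℝ) :=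
  {p | ClassS ξm ξp Vmin p.1 ∧ p.2 ∈ Set.Ioo (0 : ℝ) 2}

open Classical in
/-- The `-α`-homogeneous extension `V(x) = U(x / |x|) / |x|^α`, for `x ≠ 0`.
The value at the origin is a placeholder; see `singularPotential`. -/
def potential {n : ℕ} (p : (UnitSphere n → ℝ) × ℝ) (x : Space n) : ℝ :=
  if hx : x = 0 then 0 else p.1 (direction x hx) / ‖x‖ ^ p.2

open Classical in
/-- The potential as a function on all of `ℝ^d`, with the value `+∞` at the singularity. -/
def singularPotential {n : ℕ} (p : (UnitSphere n → ℝ) × ℝ) (x : Space n) : ℝ≥0∞ :=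
  if x = 0 then ⊤ else ENNReal.ofReal (potential p x)

/-- `x ∈ H¹((a, b); ℝ^d)`, for the continuous representative on `[a, b]`: `x` is absolutely
continuous on `[a, b]` and its (almost everywhere defined) derivative is square integrable. -/
def IsH1 {n : ℕ} (a b : ℝ) (x : ℝ → Space n) : Prop :=
  AbsolutelyContinuousOnInterval x a b ∧
    MeasureTheory.MemLp (deriv x) 2 (MeasureTheory.volume.restrict (Set.Ioo a b))

/-- The (possibly infinite) action `∫_a^b (|ẋ|² / 2 + V(x)) dt`. -/
def action {n : ℕ} (p : (UnitSphere n → ℝ) × ℝ) (a b : ℝ) (x : ℝ → Space n) : ℝ≥0∞ :=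
  ∫⁻ t in Set.Ioo a b,
    (ENNReal.ofReal (1 / 2 * ‖deriv x t‖ ^ 2) + singularPotential p (x t))

/-- `x` is an `H¹` path on `[a, b]`, `a < b`, that joins `ξm` to `ξp`. -/
structure IsAdmissible {n : ℕ} (ξm ξp : UnitSphere n) (a b : ℝ) (x : ℝ → Space n) : Prop where
  lt : a < b
  isH1 : IsH1 a b x
  left : x a = ξm
  right : x b = ξp

/-- The fixed-endpoints level `c(V)`: the infimum of the action over all time intervals and all
`H¹` paths joining `ξm` to `ξp`. -/
def level {n : ℕ} (ξm ξp : UnitSphere n) (p : (UnitSphere n → ℝ) × ℝ) : ℝ≥0∞ :=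
  sInf {A | ∃ (a b : ℝ) (x : ℝ → Space n), IsAdmissible ξm ξp a b x ∧ A = action p a b x}

/-- The path `x` on `[a, b]` achieves `c(V)`. -/
def Achieves {n : ℕ} (ξm ξp : UnitSphere n) (p : (UnitSphere n → ℝ) × ℝ)
    (a b : ℝ) (x : ℝ → Space n) : Prop :=
  IsAdmissible ξm ξp a b x ∧ action p a b x = level ξm ξp p

/-- `x` is a collisionless classical solution of `ẍ = ∇V(x)` on the open interval `(a, b)`. -/
def IsSolution {n : ℕ} (p : (UnitSphere n → ℝ) × ℝ) (a b : ℝ) (x : ℝ → Space n) : Prop :=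
  ∀ t ∈ Set.Ioo a b, x t ≠ 0 ∧ DifferentiableAt ℝ x t ∧
    HasDerivAt (deriv x) (gradient (potential p) (x t)) t

/-- `x` is, on `[a, b]`, a homothetic motion in the direction `ξ`: a solution of `ẍ = ∇V(x)` in
`(a, b)` whose angular part is constantly equal to `ξ`. -/
def IsHomothetic {n : ℕ} (p : (UnitSphere n → ℝ) × ℝ) (ξ : UnitSphere n)
    (a b : ℝ) (x : ℝ → Space n) : Prop :=
  IsSolution p a b x ∧ ∀ t ∈ Set.Icc a b, x t = ‖x t‖ • (ξ : Space n)

/-- `x` is, on `[a, b]`, the juxtaposition of a homothetic motion from `ξm` to the origin and of a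
homothetic motion from the origin to `ξp`. -/
def IsDoubleHomothetic {n : ℕ} (ξm ξp : UnitSphere n) (p : (UnitSphere n → ℝ) × ℝ)
    (a b : ℝ) (x : ℝ → Space n) : Prop :=
  x a = ξm ∧ x b = ξp ∧ ∃ τ ∈ Set.Ioo a b, x τ = 0 ∧
    IsHomothetic p ξm a τ x ∧ IsHomothetic p ξp τ b x

end AnisotropicKepler

end

/-!
Since `|ẋ|² / 2 + V(x) ≥ √(2 V(x)) |ẋ|` and `V(x) ≥ Vmin / |x| ^ α`, the action of an arc is
at least the variation along it of the radial cost
`r ↦ 2 √(2 Vmin) / (2 - α) * r ^ (1 - α / 2)`. A path that joins the sphere to the origin and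
back thus costs at least `4 √(2 Vmin) / (2 - α)`, and the two zero-energy homothetic motions
attain this bound. More generally, an action bound confines the path to a ball, where `V` is
bounded below, and so bounds the duration as well. Minimizers then come from weak
compactness of the velocities in `L²`: paths converge pointwise, and the action is lower
semicontinuous because `V` is continuous as a function into `[0, ∞]`.

If the level lies strictly below the cost of a collision, the same inequality, applied to
the two arcs that end at the point nearest to the origin, keeps minimizers uniformly away
from `0`. There the action can be varied, and the du Bois-Reymond lemma turns the vanishing
of its first variation into `ẍ = ∇V(x)`.
-/

open MeasureTheory Set Filter Topology

namespace AnisotropicKepler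

/-! ### Absolutely continuous functions -/

section AbsolutelyContinuous

variable {E : Type*} [NormedAddCommGroup E] [NormedSpace ℝ E] {a b : ℝ}

theorem absolutelyContinuousOnInterval_of_dist_le_mul {X Y : Type*} [PseudoMetricSpace X]
    [PseudoMetricSpace Y] {K : ℝ} {f : ℝ → X} {g : ℝ → Y}
    (hg : AbsolutelyContinuousOnInterval g a b)
    (h : ∀ s ∈ uIcc a b, ∀ t ∈ uIcc a b, dist (f s) (f t) ≤ K * dist (g s) (g t)) :
    AbsolutelyContinuousOnInterval f a b := by
  refine squeeze_zero' (.of_forall fun I => Finset.sum_nonneg fun i _ => dist_nonneg) ?_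
    (by simpa only [mul_zero] using Tendsto.const_mul K hg)
  filter_upwards [mem_inf_of_right (mem_principal_self _)] with I hI
  rw [Finset.mul_sum]
  exact Finset.sum_le_sum fun i hi => h _ (hI.1 i hi).1 _ (hI.1 i hi).2

theorem absolutelyContinuousOnInterval_lipschitzWith_comp {X Y : Type*} [PseudoMetricSpace X]
    [PseudoMetricSpace Y] {K : NNReal} {F : X → Y} (hF : LipschitzWith K F) {f : ℝ → X}
    (hf : AbsolutelyContinuousOnInterval f a b) :
    AbsolutelyContinuousOnInterval (F ∘ f) a b :=
  absolutelyContinuousOnInterval_of_dist_le_mul hf fun _ _ _ _ => hF.dist_le_mul _ _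

theorem absolutelyContinuousOnInterval_primitive {v : ℝ → E}
    (hv : IntervalIntegrable v volume a b) :
    AbsolutelyContinuousOnInterval (fun t => ∫ s in a..t, v s) a b := by
  refine absolutelyContinuousOnInterval_of_dist_le_mul (K := 1)
    (hv.norm.absolutelyContinuousOnInterval_intervalIntegral left_mem_uIcc) fun s hs t ht => ?_
  have hI : ∀ {r}, r ∈ uIcc a b → IntervalIntegrable v volume a r := fun hr =>
    hv.mono_set (uIcc_subset_uIcc left_mem_uIcc hr)
  rw [one_mul, dist_eq_norm, Real.dist_eq,
    intervalIntegral.integral_interval_sub_left (hI hs) (hI ht),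
    intervalIntegral.integral_interval_sub_left (hI hs).norm (hI ht).norm]
  exact intervalIntegral.norm_integral_le_abs_integral_norm

theorem integral_deriv_eq_sub_of_absolutelyContinuousOnInterval [FiniteDimensional ℝ E]
    {f : ℝ → E} (hf : AbsolutelyContinuousOnInterval f a b)
    (hf' : IntervalIntegrable (deriv f) volume a b) :
    ∫ t in a..b, deriv f t = f b - f a := by
  have : CompleteSpace E := FiniteDimensional.complete ℝ E
  obtain ⟨C, hC⟩ := (hf.fun_sub (absolutelyContinuousOnInterval_primitive hf')
    ).const_of_ae_hasDerivAt_zero (by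
      filter_upwards [hf.boundedVariationOn.ae_differentiableAt_of_mem_uIcc,
        hf'.ae_hasDerivAt_integral] with t hft hIt ht
      simpa only [sub_self] using (hft ht).hasDerivAt.fun_sub (hIt ht a left_mem_uIcc))
  have hleft : f a = C := by simpa using hC a left_mem_uIcc
  rw [hleft, ← hC b right_mem_uIcc, sub_sub_cancel]

theorem intervalIntegrable_of_memLp_Ioo {F : Type*} [NormedAddCommGroup F] {q : ℝ≥0∞}
    (hq : 1 ≤ q) {v : ℝ → F} (hv : MemLp v q (volume.restrict (Ioo a b)))
    (hab : a ≤ b) : IntervalIntegrable v volume a b :=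
  (intervalIntegrable_iff_integrableOn_Ioo_of_le hab).2 (hv.integrable hq)

theorem ae_hasDerivAt_of_eq_integral [CompleteSpace E] {f v : ℝ → E} {c : E} (hab : a ≤ b)
    (hv : IntervalIntegrable v volume a b) (hf : ∀ t ∈ Icc a b, f t = c + ∫ s in a..t, v s) :
    ∀ᵐ t ∂volume.restrict (Ioo a b), HasDerivAt f (v t) t := by
  rw [ae_restrict_iff' measurableSet_Ioo]
  filter_upwards [hv.ae_hasDerivAt_integral] with t ht htab
  have hIcc : t ∈ uIcc a b := uIcc_of_le hab ▸ Ioo_subset_Icc_self htab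
  refine ((ht hIcc a left_mem_uIcc).const_add c).congr_of_eventuallyEq ?_
  filter_upwards [isOpen_Ioo.mem_nhds htab] with s hs using hf s (Ioo_subset_Icc_self hs)

end AbsolutelyContinuous

/-! ### Sobolev paths -/

section Sobolev

variable {n : ℕ} {a b : ℝ} {x : ℝ → Space n}

theorem IsH1.intervalIntegrable_deriv (hx : IsH1 a b x) (hab : a ≤ b) :
    IntervalIntegrable (deriv x) volume a b :=
  intervalIntegrable_of_memLp_Ioo one_le_two hx.2 hab

theorem IsH1.continuousOn (hx : IsH1 a b x) (hab : a ≤ b) : ContinuousOn x (Icc a b) := by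
  simpa only [uIcc_of_le hab] using hx.1.continuousOn

theorem IsH1.ae_differentiableAt (hx : IsH1 a b x) (hab : a ≤ b) :
    ∀ᵐ t ∂volume.restrict (Ioo a b), DifferentiableAt ℝ x t := by
  rw [ae_restrict_iff' measurableSet_Ioo]
  filter_upwards [hx.1.boundedVariationOn.ae_differentiableAt_of_mem_uIcc] with t ht htab
  exact ht (uIcc_of_le hab ▸ Ioo_subset_Icc_self htab)

theorem IsH1.mono (hx : IsH1 a b x) {s t : ℝ} (has : a ≤ s) (hst : s ≤ t) (htb : t ≤ b) :
    IsH1 s t x := by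
  refine ⟨hx.1.mono ?_, hx.2.mono_measure (Measure.restrict_mono (Ioo_subset_Ioo has htb) le_rfl)⟩
  rw [uIcc_of_le hst, uIcc_of_le (has.trans (hst.trans htb))]
  exact Icc_subset_Icc has htb

theorem IsH1.eq_add_integral_deriv (hx : IsH1 a b x) {t : ℝ} (ht : t ∈ Icc a b) :
    x t = x a + ∫ s in a..t, deriv x s := by
  have hat := hx.mono le_rfl ht.1 ht.2
  rw [integral_deriv_eq_sub_of_absolutelyContinuousOnInterval hat.1
    (hat.intervalIntegrable_deriv ht.1), add_sub_cancel]

theorem isH1_of_eq_integral {c : Space n} {v : ℝ → Space n} (hab : a ≤ b)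
    (hv : MemLp v 2 (volume.restrict (Ioo a b)))
    (hx : ∀ t ∈ Icc a b, x t = c + ∫ s in a..t, v s) : IsH1 a b x := by
  have hI := intervalIntegrable_of_memLp_Ioo one_le_two hv hab
  refine ⟨absolutelyContinuousOnInterval_of_dist_le_mul (K := 1)
    (absolutelyContinuousOnInterval_primitive hI) fun s hs t ht => ?_, (memLp_congr_ae ?_).2 hv⟩
  · rw [uIcc_of_le hab] at hs ht
    rw [hx s hs, hx t ht, dist_add_left, one_mul]
  · filter_upwards [ae_hasDerivAt_of_eq_integral hab hI hx] with t ht using ht.deriv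

theorem memLp_deriv_of_action_ne_top {p : (UnitSphere n → ℝ) × ℝ}
    (hx : action p a b x ≠ ⊤) : MemLp (deriv x) 2 (volume.restrict (Ioo a b)) := by
  refine ⟨(measurable_deriv x).aestronglyMeasurable, ?_⟩
  rw [eLpNorm_lt_top_iff_lintegral_rpow_enorm_lt_top two_ne_zero ENNReal.ofNat_ne_top]
  refine lt_of_le_of_lt ?_ (ENNReal.mul_lt_top (a := 2) ENNReal.ofNat_lt_top hx.lt_top)
  rw [action, ← lintegral_const_mul' _ _ ENNReal.ofNat_ne_top]
  refine lintegral_mono fun t => ?_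
  calc ‖deriv x t‖ₑ ^ (2 : ℝ≥0∞).toReal
      = 2 * ENNReal.ofReal (1 / 2 * ‖deriv x t‖ ^ 2) := by
        rw [ENNReal.toReal_ofNat, ← ofReal_norm, ENNReal.rpow_two,
          ← ENNReal.ofReal_pow (norm_nonneg _), two_mul,
          ← ENNReal.ofReal_add (by positivity) (by positivity)]
        congr 1
        ring
    _ ≤ _ := by gcongr; exact le_self_add

theorem isH1_of_hasDerivAt_off_countable (hab : a ≤ b) {s : Set ℝ} (hs : s.Countable)
    (hcont : ContinuousOn x (Icc a b)) (hdiff : ∀ t ∈ Ioo a b \ s, DifferentiableAt ℝ x t)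
    (hderiv : MemLp (deriv x) 2 (volume.restrict (Ioo a b))) : IsH1 a b x := by
  refine isH1_of_eq_integral (c := x a) hab hderiv fun t ht => ?_
  have hsub : Ioo a t ⊆ Ioo a b := Ioo_subset_Ioo_right ht.2
  rw [integral_eq_of_hasDerivAt_off_countable_of_le x (deriv x) ht.1 hs
    (hcont.mono (Icc_subset_Icc_right ht.2)) (fun r hr => (hdiff r ⟨hsub hr.1, hr.2⟩).hasDerivAt)
    (intervalIntegrable_of_memLp_Ioo one_le_two
      (hderiv.mono_measure (Measure.restrict_mono hsub le_rfl)) ht.1), add_sub_cancel]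

end Sobolev

/-! ### The potential -/

section Potential

variable {n : ℕ} {Vmin : ℝ} {p : (UnitSphere n → ℝ) × ℝ}

theorem direction_smul {r : ℝ} (hr : 0 < r) (ξ : UnitSphere n) (h : r • (ξ : Space n) ≠ 0) :
    direction (r • (ξ : Space n)) h = ξ := by
  apply Subtype.ext
  simp [direction, norm_smul, smul_smul, abs_of_pos hr, hr.ne']

theorem smul_sphere_ne_zero {r : ℝ} (hr : r ≠ 0) (ξ : UnitSphere n) : r • (ξ : Space n) ≠ 0 :=
  smul_ne_zero hr (ne_zero_of_mem_unit_sphere ξ)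

theorem norm_smul_sphere {r : ℝ} (hr : 0 ≤ r) (ξ : UnitSphere n) : ‖r • (ξ : Space n)‖ = r := by
  rw [norm_smul, norm_eq_of_mem_sphere, mul_one, Real.norm_of_nonneg hr]

theorem potential_of_ne_zero {x : Space n} (hx : x ≠ 0) :
    potential p x = p.1 (direction x hx) / ‖x‖ ^ p.2 := dif_neg hx

theorem potential_smul {r : ℝ} (hr : 0 < r) (ξ : UnitSphere n) :
    potential p (r • (ξ : Space n)) = p.1 ξ / r ^ p.2 := by
  rw [potential_of_ne_zero (smul_sphere_ne_zero hr.ne' ξ), direction_smul hr,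
    norm_smul_sphere hr.le]

theorem le_potential (hmin : ∀ s, Vmin ≤ p.1 s) {x : Space n} (hx : x ≠ 0) :
    Vmin / ‖x‖ ^ p.2 ≤ potential p x := by
  rw [potential_of_ne_zero hx]
  exact div_le_div_of_nonneg_right (hmin _) (Real.rpow_nonneg (norm_nonneg _) _)

theorem potential_nonneg (hp : ∀ s, 0 ≤ p.1 s) (x : Space n) : 0 ≤ potential p x := by
  unfold potential
  split_ifs
  exacts [le_rfl, div_nonneg (hp _) (Real.rpow_nonneg (norm_nonneg x) _)]

theorem singularPotential_of_ne_zero {x : Space n} (hx : x ≠ 0) :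
    singularPotential p x = ENNReal.ofReal (potential p x) := if_neg hx

theorem singularPotential_zero : singularPotential p (0 : Space n) = ⊤ := if_pos rfl

theorem le_singularPotential (hmin : ∀ s, Vmin ≤ p.1 s) (x : Space n) :
    ENNReal.ofReal Vmin / ‖x‖ₑ ^ p.2 ≤ singularPotential p x := by
  rcases eq_or_ne x 0 with rfl | hx
  · exact singularPotential_zero (p := p) ▸ le_top
  · have hpos : 0 < ‖x‖ := norm_pos_iff.2 hx
    rw [singularPotential_of_ne_zero hx, ← ofReal_norm, ENNReal.ofReal_rpow_of_pos hpos,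
      ← ENNReal.ofReal_div_of_pos (Real.rpow_pos_of_pos hpos _)]
    exact ENNReal.ofReal_le_ofReal (le_potential hmin hx)

/-- `ℝ^d \ {0}` as an open set, hence as a manifold, on which `direction` is a smooth map. -/
def puncturedSpace (n : ℕ) : TopologicalSpace.Opens (Space n) := ⟨{0}ᶜ, isOpen_compl_singleton⟩

theorem contMDiff_direction {k : WithTop ℕ∞} :
    ContMDiff 𝓘(ℝ, Space n) (𝓡 n) k fun y : puncturedSpace n => direction (y : Space n) y.2 := by
  have : Fact (Module.finrank ℝ (Space n) = n + 1) := ⟨finrank_euclideanSpace_fin⟩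
  refine ContMDiff.codRestrict_sphere
    (f := fun y : puncturedSpace n => ‖(y : Space n)‖⁻¹ • (y : Space n)) (fun y => ?_)
    fun y => (direction (y : Space n) y.2).2
  have hy : (y : Space n) ≠ 0 := y.2
  exact ContMDiffAt.comp (g := fun z : Space n => ‖z‖⁻¹ • z) y
    (((contDiffAt_norm ℝ hy).inv (norm_ne_zero_iff.2 hy)).smul contDiffAt_id).contMDiffAt
    (contMDiff_subtype_val y)

theorem contDiffAt_potential {k : WithTop ℕ∞} (hU : ContMDiff (𝓡 n) 𝓘(ℝ, ℝ) k p.1) {x : Space n}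
    (hx : x ≠ 0) : ContDiffAt ℝ k (potential p) x := by
  let x₀ : puncturedSpace n := ⟨x, hx⟩
  have hpow : ContDiffAt ℝ k (fun z : Space n => (‖z‖ ^ p.2)⁻¹) x :=
    ((contDiffAt_norm ℝ hx).rpow_const_of_ne (norm_ne_zero_iff.2 hx)).inv
      (Real.rpow_pos_of_pos (norm_pos_iff.2 hx) _).ne'
  have hpow₀ : ContMDiffAt 𝓘(ℝ, Space n) 𝓘(ℝ, ℝ) k
      (fun y : puncturedSpace n => (‖(y : Space n)‖ ^ p.2)⁻¹) x₀ :=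
    ContMDiffAt.comp (g := fun z : Space n => (‖z‖ ^ p.2)⁻¹) x₀ hpow.contMDiffAt
      (contMDiff_subtype_val x₀)
  have hpot : ContMDiffAt 𝓘(ℝ, Space n) 𝓘(ℝ, ℝ) k
      (fun y : puncturedSpace n => potential p (y : Space n)) x₀ := by
    convert ((hU.comp contMDiff_direction) x₀).mul hpow₀ using 1
    funext y
    rw [potential_of_ne_zero y.2, div_eq_mul_inv, Pi.mul_apply, Function.comp_apply]
  exact (contMDiffAt_subtype_iff.1 hpot).contDiffAt

theorem continuous_singularPotential (hU : Continuous p.1) (hV : 0 < Vmin)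
    (hmin : ∀ s, Vmin ≤ p.1 s) (hα : 0 < p.2) : Continuous (singularPotential (n := n) p) := by
  refine continuous_iff_continuousAt.2 fun x => ?_
  rcases eq_or_ne x 0 with rfl | hx
  · rw [ContinuousAt, singularPotential_zero]
    refine tendsto_nhds_top_mono' ?_ (le_singularPotential hmin)
    have hpow : Tendsto (fun y : Space n => ‖y‖ₑ ^ p.2) (𝓝 0) (𝓝 0) :=
      (ENNReal.continuous_rpow_const.comp continuous_enorm).tendsto' 0 0
        (by simp [ENNReal.zero_rpow_of_pos hα])
    simpa [ENNReal.div_zero, hV] using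
      ENNReal.Tendsto.const_div (a := ENNReal.ofReal Vmin) hpow (Or.inr ENNReal.ofReal_ne_top)
  · have hpot := (contDiffAt_potential (contMDiff_zero_iff.2 hU) hx).continuousAt
    refine (ENNReal.continuous_ofReal.continuousAt.comp hpot).congr ?_
    filter_upwards [isOpen_compl_singleton.mem_nhds hx] with y hy
    exact (singularPotential_of_ne_zero hy).symm

theorem continuousAt_gradient_potential (hU : ContMDiff (𝓡 n) 𝓘(ℝ, ℝ) 1 p.1) {x : Space n}
    (hx : x ≠ 0) : ContinuousAt (gradient (potential p)) x :=
  (InnerProductSpace.toDual ℝ (Space n)).symm.continuous.continuousAt.comp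
    ((contDiffAt_potential hU hx).fderiv_right (m := 0) (zero_add _).le).continuousAt

theorem hasGradientAt_const_div_norm_rpow {E : Type*} [NormedAddCommGroup E]
    [InnerProductSpace ℝ E] [CompleteSpace E] (c q : ℝ) {x : E} (hx : x ≠ 0) :
    HasGradientAt (fun y : E => c / ‖y‖ ^ q) ((-(q * c) * ‖x‖ ^ (-q - 2)) • x) x := by
  have hsq := ((hasStrictFDerivAt_norm_sq x).hasFDerivAt.rpow_const (p := -q / 2)
    (Or.inl (by positivity))).const_mul c
  have hpow (y : E) (s : ℝ) : (‖y‖ ^ 2) ^ s = ‖y‖ ^ (2 * s) := by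
    rw [← Real.rpow_natCast_mul (norm_nonneg y), Nat.cast_two]
  have heq : (fun y : E => c / ‖y‖ ^ q) = fun y => c * (‖y‖ ^ 2) ^ (-q / 2) := by
    funext y
    rw [hpow, mul_div_cancel₀ _ two_ne_zero, Real.rpow_neg (norm_nonneg y), div_eq_mul_inv]
  rw [hasGradientAt_iff_hasFDerivAt, heq]
  refine hsq.congr_fderiv ?_
  rw [hpow, show 2 * (-q / 2 - 1) = -q - 2 by ring]
  ext y
  simp only [smul_apply, coe_innerSL_apply, nsmul_eq_mul, Nat.cast_ofNat,
    smul_eq_mul, InnerProductSpace.toDual_apply_apply, real_inner_smul_left]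
  ring

/-- At a minimal direction `ξ` the potential is touched from below by the radial potential
`p.1 ξ / ‖y‖ ^ p.2`, hence has the same gradient there. -/
theorem gradient_potential_smul (hU : ContMDiff (𝓡 n) 𝓘(ℝ, ℝ) 1 p.1) {ξ : UnitSphere n}
    (hξ : ∀ s, p.1 ξ ≤ p.1 s) {r : ℝ} (hr : 0 < r) :
    gradient (potential p) (r • (ξ : Space n)) =
      (-(p.2 * p.1 ξ) * r ^ (-p.2 - 1)) • (ξ : Space n) := by
  have hne := smul_sphere_ne_zero hr.ne' ξ
  have hpot := ((contDiffAt_potential hU hne).differentiableAt one_ne_zero).hasGradientAt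
  have hrad := hasGradientAt_const_div_norm_rpow (p.1 ξ) p.2 hne
  have hloc : IsLocalMin (fun y => potential p y - p.1 ξ / ‖y‖ ^ p.2) (r • (ξ : Space n)) := by
    filter_upwards [isOpen_compl_singleton.mem_nhds hne] with y hy
    rw [potential_smul hr, norm_smul_sphere hr.le, sub_self]
    exact sub_nonneg.2 (le_potential hξ hy)
  have hgrad := (InnerProductSpace.toDual ℝ (Space n)).injective
    (sub_eq_zero.1 (hloc.hasFDerivAt_eq_zero (hpot.hasFDerivAt.sub hrad.hasFDerivAt)))
  rw [hgrad, norm_smul_sphere hr.le, smul_smul, mul_assoc, ← Real.rpow_add_one hr.ne']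
  congr 3
  ring

end Potential

/-! ### The radial cost -/

section RadialCost

variable {n : ℕ} {ξm ξp : UnitSphere n} {Vmin α : ℝ} {p : (UnitSphere n → ℝ) × ℝ} {a b : ℝ}
  {x : ℝ → Space n}

/-- The least action needed to join a sphere of radius `r` to the origin: the length of the radius
for the Jacobi metric `√(2 V) |dx|` of the radial potential `V = Vmin / r ^ α`. -/
noncomputable def radialCost (Vmin α r : ℝ) : ℝ := 2 * √(2 * Vmin) / (2 - α) * r ^ (1 - α / 2)

theorem two_mul_radialCost_one (Vmin α : ℝ) :
    2 * radialCost Vmin α 1 = 4 * √(2 * Vmin) / (2 - α) := by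
  rw [radialCost, Real.one_rpow]
  ring

theorem radialCost_zero (Vmin : ℝ) (hα : α < 2) : radialCost Vmin α 0 = 0 := by
  rw [radialCost, Real.zero_rpow (by linarith), mul_zero]

theorem continuous_radialCost (Vmin : ℝ) (hα : α < 2) : Continuous (radialCost Vmin α) :=
  continuous_const.mul (continuous_id.rpow_const fun _ => Or.inr (by linarith))

theorem hasDerivAt_radialCost (Vmin : ℝ) (hα : α < 2) {r : ℝ} (hr : 0 < r) :
    HasDerivAt (radialCost Vmin α) (√(2 * Vmin) * r ^ (-(α / 2))) r := by
  have h := (Real.hasDerivAt_rpow_const (p := 1 - α / 2) (Or.inl hr.ne')).const_mul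
    (2 * √(2 * Vmin) / (2 - α))
  refine h.congr_deriv ?_
  have : 2 - α ≠ 0 := by linarith
  rw [show 1 - α / 2 - 1 = -(α / 2) by ring]
  field_simp

theorem sq_sqrt_two_mul_mul_rpow (hV : 0 ≤ Vmin) (α : ℝ) {r : ℝ} (hr : 0 < r) :
    (√(2 * Vmin) * r ^ (-(α / 2))) ^ 2 = 2 * (Vmin / r ^ α) := by
  rw [mul_pow, Real.sq_sqrt (by positivity), ← Real.rpow_mul_natCast hr.le, Nat.cast_two,
    neg_mul, div_mul_cancel₀ _ two_ne_zero, Real.rpow_neg hr.le]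
  ring

theorem radialCost_coeff_pos (hV : 0 < Vmin) (hα : α < 2) : 0 < 2 * √(2 * Vmin) / (2 - α) := by
  have : 0 < 2 - α := by linarith
  positivity

theorem strictMonoOn_radialCost (hV : 0 < Vmin) (hα : α < 2) :
    StrictMonoOn (radialCost Vmin α) (Ici 0) := fun _ hr _ _ hrs =>
  mul_lt_mul_of_pos_left (Real.rpow_lt_rpow hr hrs (by linarith)) (radialCost_coeff_pos hV hα)

theorem tendsto_radialCost_atTop (hV : 0 < Vmin) (hα : α < 2) :
    Tendsto (radialCost Vmin α) atTop atTop :=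
  (tendsto_rpow_atTop (by linarith)).const_mul_atTop (radialCost_coeff_pos hV hα)

theorem lipschitzWith_radialCost_norm_add {E : Type*} [SeminormedAddCommGroup E] (Vmin : ℝ)
    (hα0 : 0 ≤ α) (hα : α < 2) {ε : ℝ} (hε : 0 < ε) :
    LipschitzWith (√(2 * Vmin) * ε ^ (-(α / 2))).toNNReal
      (fun y : E => radialCost Vmin α (‖y‖ + ε)) := by
  have hC : 0 ≤ √(2 * Vmin) * ε ^ (-(α / 2)) := by positivity
  refine LipschitzWith.of_dist_le_mul fun y z => ?_
  have hmem (w : E) : ‖w‖ + ε ∈ Ici ε := le_add_of_nonneg_left (norm_nonneg w)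
  have hmvt := (convex_Ici ε).norm_image_sub_le_of_norm_hasDerivWithin_le
    (fun r hr => (hasDerivAt_radialCost Vmin hα (hε.trans_le hr)).hasDerivWithinAt)
    (fun r hr => by
      rw [Real.norm_of_nonneg (mul_nonneg (Real.sqrt_nonneg _)
        (Real.rpow_nonneg (hε.le.trans hr) _))]
      exact mul_le_mul_of_nonneg_left (Real.rpow_le_rpow_of_nonpos hε hr (by linarith))
        (Real.sqrt_nonneg _))
    (hmem z) (hmem y)
  rw [add_sub_add_right_eq_sub] at hmvt
  rw [Real.coe_toNNReal _ hC, dist_eq_norm, dist_eq_norm]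
  exact hmvt.trans (mul_le_mul_of_nonneg_left (abs_norm_sub_norm_le y z) hC)

theorem exists_hasDerivAt_norm {E : Type*} [NormedAddCommGroup E] [InnerProductSpace ℝ E]
    {f : ℝ → E} {v : E} {t : ℝ} (hf : HasDerivAt f v t) (h0 : f t ≠ 0) :
    ∃ u, |u| ≤ ‖v‖ ∧ HasDerivAt (fun s => ‖f s‖) u t := by
  have hnorm := ((contDiffAt_norm (n := 1) ℝ h0).differentiableAt one_ne_zero).hasFDerivAt
  refine ⟨_, ?_, hnorm.comp_hasDerivAt t hf⟩
  simpa using ContinuousLinearMap.le_of_opNorm_le _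
    (norm_fderiv_le_of_lipschitz ℝ (lipschitzWith_one_norm (E := E))) v

/-- The pointwise bound of the action density from below, by the inequality
`√(2 V) |ẋ| ≤ |ẋ|² / 2 + V`. Shifting the radius by `ε` makes the radial cost Lipschitz, so that it
can be composed with a path that goes through the origin. -/
theorem enorm_deriv_radialCost_norm_add_le (hV : 0 ≤ Vmin) (hmin : ∀ s, Vmin ≤ p.1 s)
    (hα0 : 0 ≤ p.2) (hα : p.2 < 2) {ε : ℝ} (hε : 0 < ε) {t : ℝ} (hx : DifferentiableAt ℝ x t) :
    ‖deriv (fun s => radialCost Vmin p.2 (‖x s‖ + ε)) t‖ₑ ≤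
      ENNReal.ofReal (1 / 2 * ‖deriv x t‖ ^ 2) + singularPotential p (x t) := by
  rcases eq_or_ne (x t) 0 with h0 | h0
  · rw [h0, singularPotential_zero, add_top]
    exact le_top
  have hpos : 0 < ‖x t‖ := norm_pos_iff.2 h0
  obtain ⟨u, hu, hnorm⟩ := exists_hasDerivAt_norm hx.hasDerivAt h0
  have hderiv := ((hasDerivAt_radialCost Vmin hα (r := ‖x t‖ + ε) (by positivity)).comp t
    (hnorm.add_const ε)).deriv
  have hle := le_potential hmin h0
  rw [singularPotential_of_ne_zero h0, ← ENNReal.ofReal_add (by positivity)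
    ((by positivity : 0 ≤ Vmin / ‖x t‖ ^ p.2).trans hle), ← ofReal_norm]
  refine ENNReal.ofReal_le_ofReal ?_
  set c := √(2 * Vmin) * ‖x t‖ ^ (-(p.2 / 2))
  calc _ = √(2 * Vmin) * (‖x t‖ + ε) ^ (-(p.2 / 2)) * |u| := by
        rw [← Function.comp_def (radialCost Vmin p.2), hderiv, norm_mul,
          Real.norm_of_nonneg (by positivity), Real.norm_eq_abs]
    _ ≤ c * ‖deriv x t‖ := by
        refine mul_le_mul (mul_le_mul_of_nonneg_left ?_ (Real.sqrt_nonneg _)) hu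
          (abs_nonneg u) (by positivity)
        exact Real.rpow_le_rpow_of_nonpos hpos (by linarith) (by linarith)
    _ ≤ 1 / 2 * ‖deriv x t‖ ^ 2 + Vmin / ‖x t‖ ^ p.2 := by
        linarith [two_mul_le_add_sq c ‖deriv x t‖, sq_sqrt_two_mul_mul_rpow hV p.2 hpos]
    _ ≤ _ := by gcongr

theorem ofReal_abs_radialCost_sub_le_action (hV : 0 ≤ Vmin) (hmin : ∀ s, Vmin ≤ p.1 s)
    (hα0 : 0 ≤ p.2) (hα : p.2 < 2) (hab : a ≤ b) (hx : IsH1 a b x) :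
    ENNReal.ofReal |radialCost Vmin p.2 ‖x b‖ - radialCost Vmin p.2 ‖x a‖| ≤ action p a b x := by
  have hshift : ∀ ε : ℝ, 0 < ε → ENNReal.ofReal
      |radialCost Vmin p.2 (‖x b‖ + ε) - radialCost Vmin p.2 (‖x a‖ + ε)| ≤ action p a b x := by
    intro ε hε
    have hac := absolutelyContinuousOnInterval_lipschitzWith_comp
      (lipschitzWith_radialCost_norm_add Vmin hα0 hα hε) hx.1
    have hftc := hac.integral_deriv_eq_sub
    simp only [Function.comp_def] at hftc
    rw [← hftc, ← Real.norm_eq_abs, ofReal_norm, intervalIntegral.integral_of_le hab,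
      ← restrict_Ioo_eq_restrict_Ioc]
    refine (enorm_integral_le_lintegral_enorm _).trans (lintegral_mono_ae ?_)
    filter_upwards [hx.ae_differentiableAt hab] with t ht
    exact enorm_deriv_radialCost_norm_add_le hV hmin hα0 hα hε ht
  have hcont : Continuous fun ε : ℝ => ENNReal.ofReal
      |radialCost Vmin p.2 (‖x b‖ + ε) - radialCost Vmin p.2 (‖x a‖ + ε)| :=
    have := continuous_radialCost Vmin hα
    ENNReal.continuous_ofReal.comp (by fun_prop)
  have hlim := (hcont.tendsto 0).mono_left (nhdsWithin_le_nhds (s := Ioi 0))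
  simp only [add_zero] at hlim
  exact le_of_tendsto hlim (by filter_upwards [self_mem_nhdsWithin] with ε hε using hshift ε hε)

theorem action_add {c : ℝ} (hac : a ≤ c) (hcb : c ≤ b) :
    action p a c x + action p c b x = action p a b x := by
  simp only [action, restrict_Ioo_eq_restrict_Ioc]
  rw [← Ioc_union_Ioc_eq_Ioc hac hcb,
    lintegral_union measurableSet_Ioc (Ioc_disjoint_Ioc_of_le le_rfl)]

theorem IsAdmissible.two_mul_abs_radialCost_sub_le (hV : 0 ≤ Vmin) (hmin : ∀ s, Vmin ≤ p.1 s)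
    (hα0 : 0 ≤ p.2) (hα : p.2 < 2) (hx : IsAdmissible ξm ξp a b x) {t : ℝ} (ht : t ∈ Icc a b) :
    ENNReal.ofReal (2 * |radialCost Vmin p.2 ‖x t‖ - radialCost Vmin p.2 1|) ≤
      action p a b x := by
  have hleft := ofReal_abs_radialCost_sub_le_action hV hmin hα0 hα ht.1
    (hx.isH1.mono le_rfl ht.1 ht.2)
  have hright := ofReal_abs_radialCost_sub_le_action hV hmin hα0 hα ht.2
    (hx.isH1.mono ht.1 ht.2 le_rfl)
  rw [hx.left, norm_eq_of_mem_sphere] at hleft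
  rw [hx.right, norm_eq_of_mem_sphere, abs_sub_comm] at hright
  rw [two_mul, ENNReal.ofReal_add (abs_nonneg _) (abs_nonneg _), ← action_add ht.1 ht.2]
  exact add_le_add hleft hright

theorem exists_norm_le_of_action_le (hV : 0 < Vmin) (hmin : ∀ s, Vmin ≤ p.1 s) (hα0 : 0 ≤ p.2)
    (hα : p.2 < 2) {A : ℝ≥0∞} (hA : A ≠ ⊤) :
    ∃ R > 0, ∀ (ξm ξp : UnitSphere n) (a b : ℝ) (x : ℝ → Space n),
      IsAdmissible ξm ξp a b x → action p a b x ≤ A → ∀ t ∈ Icc a b, ‖x t‖ ≤ R := by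
  obtain ⟨R, hR, hR0⟩ := (((tendsto_radialCost_atTop hV hα).eventually_gt_atTop
    (radialCost Vmin p.2 1 + A.toReal / 2)).and (eventually_gt_atTop 0)).exists
  refine ⟨R, hR0, fun ξm ξp a b x hx hxA t ht => ?_⟩
  have hcost := (ENNReal.ofReal_le_iff_le_toReal hA).1
    ((hx.two_mul_abs_radialCost_sub_le hV.le hmin hα0 hα ht).trans hxA)
  rw [← (strictMonoOn_radialCost hV hα).le_iff_le (mem_Ici.2 (norm_nonneg _)) (mem_Ici.2 hR0.le)]
  linarith [le_abs_self (radialCost Vmin p.2 ‖x t‖ - radialCost Vmin p.2 1)]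

theorem exists_le_norm_of_action_le (hV : 0 < Vmin) (hmin : ∀ s, Vmin ≤ p.1 s) (hα0 : 0 ≤ p.2)
    (hα : p.2 < 2) {A : ℝ≥0∞} (hA : A < ENNReal.ofReal (2 * radialCost Vmin p.2 1)) :
    ∃ ρ > 0, ∀ (ξm ξp : UnitSphere n) (a b : ℝ) (x : ℝ → Space n),
      IsAdmissible ξm ξp a b x → action p a b x ≤ A → ∀ t ∈ Icc a b, ρ ≤ ‖x t‖ := by
  have hA' := (ENNReal.lt_ofReal_iff_toReal_lt (ne_top_of_lt hA)).1 hA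
  have hnear : ∀ᶠ r in 𝓝[>] (0 : ℝ), radialCost Vmin p.2 r < radialCost Vmin p.2 1 - A.toReal / 2 :=
    ((continuous_radialCost Vmin hα).tendsto' 0 0 (radialCost_zero Vmin hα)).mono_left
      nhdsWithin_le_nhds |>.eventually_lt_const (by linarith)
  obtain ⟨ρ, hρ, hρ0⟩ := (hnear.and self_mem_nhdsWithin).exists
  refine ⟨ρ, hρ0, fun ξm ξp a b x hx hxA t ht => ?_⟩
  have hcost := (ENNReal.ofReal_le_iff_le_toReal (ne_top_of_lt hA)).1
    ((hx.two_mul_abs_radialCost_sub_le hV.le hmin hα0 hα ht).trans hxA)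
  rw [← (strictMonoOn_radialCost hV hα).le_iff_le (mem_Ici.2 (le_of_lt hρ0))
    (mem_Ici.2 (norm_nonneg _))]
  linarith [neg_abs_le (radialCost Vmin p.2 ‖x t‖ - radialCost Vmin p.2 1)]

end RadialCost

/-! ### The collision path -/

section TimeReversal

variable {n : ℕ} {p : (UnitSphere n → ℝ) × ℝ} {a b : ℝ} {x : ℝ → Space n}

theorem action_comp_neg : action p (-b) (-a) (fun t => x (-t)) = action p a b x := by
  have h := (Measure.measurePreserving_neg (volume : Measure ℝ)).setLIntegral_comp_preimage_emb
    (MeasurableEquiv.neg ℝ).measurableEmbedding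
    (fun t => ENNReal.ofReal (1 / 2 * ‖deriv x t‖ ^ 2) + singularPotential p (x t)) (Ioo a b)
  simpa only [action, deriv_comp_neg, norm_neg, neg_preimage, neg_Ioo] using h

theorem IsSolution.comp_neg (hx : IsSolution p a b x) :
    IsSolution p (-b) (-a) fun t => x (-t) := by
  intro t ht
  obtain ⟨hne, hdiff, hode⟩ := hx (-t) ⟨by linarith [ht.2], by linarith [ht.1]⟩
  refine ⟨hne, hdiff.comp t differentiableAt_id.neg, ?_⟩
  have hderiv : deriv (fun s => x (-s)) = -(deriv x ∘ Neg.neg) := funext (deriv_comp_neg x)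
  simpa [hderiv] using (hode.scomp t (hasDerivAt_neg t)).neg

theorem IsHomothetic.comp_neg {ξ : UnitSphere n} (hx : IsHomothetic p ξ a b x) :
    IsHomothetic p ξ (-b) (-a) fun t => x (-t) :=
  ⟨hx.1.comp_neg, fun t ht => hx.2 (-t) ⟨by linarith [ht.2], by linarith [ht.1]⟩⟩

end TimeReversal

section Collision

variable {n : ℕ} {ξm ξp : UnitSphere n} {Vmin α t : ℝ} {p : (UnitSphere n → ℝ) × ℝ}

/-- The rate at which `r ^ (1 + α / 2)` grows along a zero-energy homothetic motion. -/
noncomputable def collisionRate (Vmin α : ℝ) : ℝ := (1 + α / 2) * √(2 * Vmin)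

/-- The distance to the origin, along a zero-energy homothetic motion that collides at time `0`:
the solution of `r' = √(2 Vmin) r ^ (-α / 2)` with `r 0 = 0`, extended evenly to negative times. -/
noncomputable def homotheticRadius (Vmin α t : ℝ) : ℝ :=
  (collisionRate Vmin α * |t|) ^ (2 / (2 + α))

/-- The juxtaposition at time `0` of the two zero-energy homothetic motions in the directions `ξm`
and `ξp`. -/
noncomputable def collisionPath (ξm ξp : UnitSphere n) (Vmin α t : ℝ) : Space n :=
  if t ≤ 0 then homotheticRadius Vmin α t • (ξm : Space n)
  else homotheticRadius Vmin α t • (ξp : Space n)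

theorem collisionRate_pos (hV : 0 < Vmin) (hα : 0 < α) : 0 < collisionRate Vmin α := by
  unfold collisionRate
  positivity

theorem homotheticRadius_zero (Vmin : ℝ) (hα : 0 < α) : homotheticRadius Vmin α 0 = 0 := by
  rw [homotheticRadius, abs_zero, mul_zero, Real.zero_rpow (by positivity)]

theorem homotheticRadius_nonneg (hV : 0 < Vmin) (hα : 0 < α) : 0 ≤ homotheticRadius Vmin α t :=
  Real.rpow_nonneg (mul_nonneg (collisionRate_pos hV hα).le (abs_nonneg t)) _

theorem homotheticRadius_pos (hV : 0 < Vmin) (hα : 0 < α) (ht : 0 < t) :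
    0 < homotheticRadius Vmin α t :=
  Real.rpow_pos_of_pos (mul_pos (collisionRate_pos hV hα) (abs_pos.2 ht.ne')) _

theorem homotheticRadius_inv_collisionRate (hV : 0 < Vmin) (hα : 0 < α) :
    homotheticRadius Vmin α (collisionRate Vmin α)⁻¹ = 1 := by
  have hc := collisionRate_pos hV hα
  rw [homotheticRadius, abs_of_pos (inv_pos.2 hc), mul_inv_cancel₀ hc.ne', Real.one_rpow]

theorem continuous_homotheticRadius (Vmin : ℝ) (hα : 0 < α) :
    Continuous (homotheticRadius Vmin α) :=
  (continuous_const.mul continuous_abs).rpow_const fun _ => Or.inr (by positivity)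

theorem hasDerivAt_homotheticRadius (hV : 0 < Vmin) (hα : 0 < α) (ht : 0 < t) :
    HasDerivAt (homotheticRadius Vmin α)
      (√(2 * Vmin) * homotheticRadius Vmin α t ^ (-(α / 2))) t := by
  have hpos : 0 < collisionRate Vmin α * t := mul_pos (collisionRate_pos hV hα) ht
  have hpow := ((hasDerivAt_id t).const_mul (collisionRate Vmin α)).rpow_const
    (p := 2 / (2 + α)) (Or.inl hpos.ne')
  refine (hpow.congr_deriv ?_).congr_of_eventuallyEq ?_
  · have hexp : 2 / (2 + α) * -(α / 2) = 2 / (2 + α) - 1 := by field_simp; ring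
    have hrate : collisionRate Vmin α * (2 / (2 + α)) = √(2 * Vmin) := by
      rw [collisionRate]; field_simp
    rw [homotheticRadius, abs_of_pos ht, ← Real.rpow_mul hpos.le, hexp, mul_one, hrate, id]
  · filter_upwards [lt_mem_nhds ht] with s hs
    rw [homotheticRadius, abs_of_pos hs, id]

theorem hasDerivAt_homotheticSpeed (hV : 0 < Vmin) (hα : 0 < α) (ht : 0 < t) :
    HasDerivAt (fun s => √(2 * Vmin) * homotheticRadius Vmin α s ^ (-(α / 2)))
      (-(α * Vmin) * homotheticRadius Vmin α t ^ (-α - 1)) t := by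
  have hr := homotheticRadius_pos hV hα ht
  refine (((hasDerivAt_homotheticRadius hV hα ht).rpow_const (p := -(α / 2))
    (Or.inl hr.ne')).const_mul _).congr_deriv ?_
  rw [show -α - 1 = -(α / 2) + (-(α / 2) - 1) by ring, Real.rpow_add hr]
  linear_combination (-(α / 2) * homotheticRadius Vmin α t ^ (-(α / 2)) *
    homotheticRadius Vmin α t ^ (-(α / 2) - 1)) * Real.mul_self_sqrt (by positivity : 0 ≤ 2 * Vmin)

/-- Along the homothetic motion the radial cost grows at the rate of the action, because the energy
is zero: `r' ^ 2 / 2 = Vmin / r ^ α`. -/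
theorem hasDerivAt_radialCost_homotheticRadius (hV : 0 < Vmin) (hα0 : 0 < α) (hα : α < 2)
    (ht : 0 < t) : HasDerivAt (fun s => radialCost Vmin α (homotheticRadius Vmin α s))
      (2 * (Vmin / homotheticRadius Vmin α t ^ α)) t := by
  have hr := homotheticRadius_pos hV hα0 ht
  refine ((hasDerivAt_radialCost Vmin hα hr).comp t
    (hasDerivAt_homotheticRadius hV hα0 ht)).congr_deriv ?_
  rw [← sq, sq_sqrt_two_mul_mul_rpow hV.le α hr]

theorem collisionPath_of_pos (ht : 0 < t) :
    collisionPath ξm ξp Vmin α t = homotheticRadius Vmin α t • (ξp : Space n) :=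
  if_neg ht.not_ge

theorem collisionPath_zero (hα : 0 < α) : collisionPath ξm ξp Vmin α 0 = 0 := by
  rw [collisionPath, if_pos le_rfl, homotheticRadius_zero Vmin hα, zero_smul]

theorem collisionPath_neg (hα : 0 < α) (t : ℝ) :
    collisionPath ξm ξp Vmin α (-t) = collisionPath ξp ξm Vmin α t := by
  have hr : homotheticRadius Vmin α (-t) = homotheticRadius Vmin α t := by
    rw [homotheticRadius, abs_neg, homotheticRadius]
  rcases lt_trichotomy t 0 with ht | rfl | ht
  · rw [collisionPath, collisionPath, if_neg (by linarith), if_pos ht.le, hr]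
  · rw [neg_zero, collisionPath_zero hα, collisionPath_zero hα]
  · rw [collisionPath, collisionPath, if_pos (by linarith), if_neg ht.not_ge, hr]

theorem continuous_collisionPath (Vmin : ℝ) (hα : 0 < α) :
    Continuous (collisionPath ξm ξp Vmin α) := by
  have hr := continuous_homotheticRadius Vmin hα
  refine Continuous.if_le (hr.smul continuous_const) (hr.smul continuous_const) continuous_id
    continuous_const fun t ht => ?_
  rw [show t = 0 from ht, homotheticRadius_zero Vmin hα, zero_smul, zero_smul]

theorem hasDerivAt_collisionPath (hV : 0 < Vmin) (hα : 0 < α) (ht : 0 < t) :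
    HasDerivAt (collisionPath ξm ξp Vmin α)
      ((√(2 * Vmin) * homotheticRadius Vmin α t ^ (-(α / 2))) • (ξp : Space n)) t := by
  refine ((hasDerivAt_homotheticRadius hV hα ht).smul_const (ξp : Space n)).congr_of_eventuallyEq ?_
  filter_upwards [lt_mem_nhds ht] with s hs using collisionPath_of_pos hs

theorem isHomothetic_collisionPath_right (hU : ContMDiff (𝓡 n) 𝓘(ℝ, ℝ) 1 p.1) (hV : 0 < p.1 ξp)
    (hα : 0 < p.2) (hmin : ∀ s, p.1 ξp ≤ p.1 s) (T : ℝ) :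
    IsHomothetic p ξp 0 T (collisionPath ξm ξp (p.1 ξp) p.2) := by
  refine ⟨fun t ht => ⟨?_, (hasDerivAt_collisionPath hV hα ht.1).differentiableAt, ?_⟩,
    fun t ht => ?_⟩
  · rw [collisionPath_of_pos ht.1]
    exact smul_sphere_ne_zero (homotheticRadius_pos hV hα ht.1).ne' ξp
  · rw [collisionPath_of_pos ht.1,
      gradient_potential_smul hU hmin (homotheticRadius_pos hV hα ht.1)]
    refine ((hasDerivAt_homotheticSpeed hV hα ht.1).smul_const (ξp : Space n)
      ).congr_of_eventuallyEq ?_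
    filter_upwards [lt_mem_nhds ht.1] with s hs using (hasDerivAt_collisionPath hV hα hs).deriv
  · rcases ht.1.eq_or_lt with rfl | ht0
    · rw [collisionPath_zero hα, norm_zero, zero_smul]
    · rw [collisionPath_of_pos ht0, norm_smul_sphere (homotheticRadius_nonneg hV hα)]

theorem action_collisionPath_right (hV : 0 < p.1 ξp) (hα0 : 0 < p.2) (hα : p.2 < 2) {T : ℝ}
    (hT : 0 ≤ T) : action p 0 T (collisionPath ξm ξp (p.1 ξp) p.2) =
      ENNReal.ofReal (radialCost (p.1 ξp) p.2 (homotheticRadius (p.1 ξp) p.2 T)) := by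
  have hcont : ContinuousOn (fun t => radialCost (p.1 ξp) p.2 (homotheticRadius (p.1 ξp) p.2 t))
      (Icc 0 T) :=
    ((continuous_radialCost _ hα).comp (continuous_homotheticRadius _ hα0)).continuousOn
  have hderiv (t : ℝ) (ht : t ∈ Ioo 0 T) :=
    hasDerivAt_radialCost_homotheticRadius hV hα0 hα ht.1
  have hnonneg (t : ℝ) (_ : t ∈ Ioo 0 T) :
      0 ≤ 2 * (p.1 ξp / homotheticRadius (p.1 ξp) p.2 t ^ p.2) :=
    mul_nonneg zero_le_two (div_nonneg hV.le (Real.rpow_nonneg (homotheticRadius_nonneg hV hα0) _))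
  have hint := intervalIntegral.integrableOn_deriv_of_nonneg hcont hderiv hnonneg
  have hint' : IntegrableOn (fun t => 2 * (p.1 ξp / homotheticRadius (p.1 ξp) p.2 t ^ p.2))
      (Ioo 0 T) := hint.mono_set Ioo_subset_Ioc_self
  have hftc := intervalIntegral.integral_eq_sub_of_hasDerivAt_of_le hT hcont hderiv
    ((intervalIntegrable_iff_integrableOn_Ioc_of_le hT).2 hint)
  rw [homotheticRadius_zero _ hα0, radialCost_zero _ hα, sub_zero,
    intervalIntegral.integral_of_le hT, ← restrict_Ioo_eq_restrict_Ioc] at hftc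
  rw [← hftc, ofReal_integral_eq_lintegral_ofReal hint'
    ((ae_restrict_iff' measurableSet_Ioo).2 (.of_forall hnonneg)), action]
  refine setLIntegral_congr_fun measurableSet_Ioo fun t ht => ?_
  have hr := homotheticRadius_pos hV hα0 ht.1
  simp only [(hasDerivAt_collisionPath hV hα0 ht.1).deriv, norm_smul, norm_eq_of_mem_sphere]
  rw [collisionPath_of_pos ht.1, singularPotential_of_ne_zero (smul_sphere_ne_zero hr.ne' ξp),
    potential_smul hr, ← ENNReal.ofReal_add (by positivity) (by positivity), mul_one,
    Real.norm_eq_abs, sq_abs, sq_sqrt_two_mul_mul_rpow hV.le _ hr]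
  congr 1
  ring

theorem isHomothetic_collisionPath_left (hU : ContMDiff (𝓡 n) 𝓘(ℝ, ℝ) 1 p.1) (hV : 0 < p.1 ξm)
    (hα : 0 < p.2) (hmin : ∀ s, p.1 ξm ≤ p.1 s) (T : ℝ) :
    IsHomothetic p ξm (-T) 0 (collisionPath ξm ξp (p.1 ξm) p.2) := by
  simpa only [collisionPath_neg hα, neg_zero] using
    (isHomothetic_collisionPath_right (ξm := ξp) hU hV hα hmin T).comp_neg

theorem action_collisionPath (hV : 0 < Vmin) (hα0 : 0 < p.2) (hα : p.2 < 2)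
    (hξm : p.1 ξm = Vmin) (hξp : p.1 ξp = Vmin) :
    action p (-(collisionRate Vmin p.2)⁻¹) (collisionRate Vmin p.2)⁻¹
      (collisionPath ξm ξp Vmin p.2) = ENNReal.ofReal (2 * radialCost Vmin p.2 1) := by
  have hT := (inv_pos.2 (collisionRate_pos hV hα0)).le
  have hhalf {ξ ξ' : UnitSphere n} (hξ' : p.1 ξ' = Vmin) :
      action p 0 (collisionRate Vmin p.2)⁻¹ (collisionPath ξ ξ' Vmin p.2) =
        ENNReal.ofReal (radialCost Vmin p.2 1) := by
    subst hξ'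
    rw [action_collisionPath_right hV hα0 hα hT, homotheticRadius_inv_collisionRate hV hα0]
  have hleft := action_comp_neg (p := p) (a := 0) (b := (collisionRate Vmin p.2)⁻¹)
    (x := collisionPath ξp ξm Vmin p.2)
  simp only [collisionPath_neg hα0, neg_zero, hhalf hξm] at hleft
  rw [← action_add (neg_nonpos.2 hT) hT, hleft, hhalf hξp, ← ENNReal.ofReal_add, two_mul] <;>
  exact mul_nonneg (radialCost_coeff_pos hV hα).le (Real.rpow_nonneg zero_le_one _)

theorem collisionPath_inv_collisionRate (hV : 0 < Vmin) (hα : 0 < α) :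
    collisionPath ξm ξp Vmin α (collisionRate Vmin α)⁻¹ = ξp := by
  rw [collisionPath_of_pos (inv_pos.2 (collisionRate_pos hV hα)),
    homotheticRadius_inv_collisionRate hV hα, one_smul]

theorem collisionPath_neg_inv_collisionRate (hV : 0 < Vmin) (hα : 0 < α) :
    collisionPath ξm ξp Vmin α (-(collisionRate Vmin α)⁻¹) = ξm := by
  rw [collisionPath_neg hα, collisionPath_inv_collisionRate hV hα]

theorem isAdmissible_collisionPath (hV : 0 < Vmin) (hα0 : 0 < p.2) (hα : p.2 < 2)
    (hξm : p.1 ξm = Vmin) (hξp : p.1 ξp = Vmin) :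
    IsAdmissible ξm ξp (-(collisionRate Vmin p.2)⁻¹) (collisionRate Vmin p.2)⁻¹
      (collisionPath ξm ξp Vmin p.2) := by
  have hlt : -(collisionRate Vmin p.2)⁻¹ < (collisionRate Vmin p.2)⁻¹ :=
    neg_lt_self (inv_pos.2 (collisionRate_pos hV hα0))
  refine ⟨hlt, isH1_of_hasDerivAt_off_countable hlt.le (countable_singleton 0)
    (continuous_collisionPath Vmin hα0).continuousOn (fun t ht => ?_)
    (memLp_deriv_of_action_ne_top
      (ne_of_eq_of_ne (action_collisionPath hV hα0 hα hξm hξp) ENNReal.ofReal_ne_top)),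
    collisionPath_neg_inv_collisionRate hV hα0, collisionPath_inv_collisionRate hV hα0⟩
  rcases lt_or_gt_of_ne (show t ≠ 0 from ht.2) with ht0 | ht0
  · rw [← funext (collisionPath_neg (ξm := ξp) (ξp := ξm) (Vmin := Vmin) hα0)]
    exact (hasDerivAt_collisionPath hV hα0 (neg_pos.2 ht0)).differentiableAt.comp t
      differentiableAt_id.neg
  · exact (hasDerivAt_collisionPath hV hα0 ht0).differentiableAt

theorem isDoubleHomothetic_collisionPath (hU : ContMDiff (𝓡 n) 𝓘(ℝ, ℝ) 1 p.1) (hV : 0 < Vmin)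
    (hα : 0 < p.2) (hξm : p.1 ξm = Vmin) (hξp : p.1 ξp = Vmin) (hmin : ∀ s, Vmin ≤ p.1 s) :
    IsDoubleHomothetic ξm ξp p (-(collisionRate Vmin p.2)⁻¹) (collisionRate Vmin p.2)⁻¹
      (collisionPath ξm ξp Vmin p.2) := by
  have hT : 0 < (collisionRate Vmin p.2)⁻¹ := inv_pos.2 (collisionRate_pos hV hα)
  refine ⟨collisionPath_neg_inv_collisionRate hV hα, collisionPath_inv_collisionRate hV hα, 0,
    ⟨neg_neg_of_pos hT, hT⟩, collisionPath_zero hα, ?_, ?_⟩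
  · subst hξm
    exact isHomothetic_collisionPath_left hU hV hα hmin _
  · subst hξp
    exact isHomothetic_collisionPath_right hU hV hα hmin _

end Collision

/-! ### Existence of minimizers -/

section WeakCompactness

theorem exists_subseq_tendsto_inner {H : Type*} [NormedAddCommGroup H] [InnerProductSpace ℝ H]
    [CompleteSpace H] [TopologicalSpace.SeparableSpace H] {w : ℕ → H} {C : ℝ}
    (hw : ∀ k, ‖w k‖ ≤ C) :
    ∃ (v : H) (φ : ℕ → ℕ), StrictMono φ ∧
      ∀ u : H, Tendsto (fun k => inner ℝ u (w (φ k))) atTop (𝓝 (inner ℝ u v)) := by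
  obtain ⟨f, -, φ, hφ, hlim⟩ := WeakDual.isSeqCompact_closedBall ℝ H 0 C
    (x := fun k => StrongDual.toWeakDual (InnerProductSpace.toDual ℝ H (w k)))
    (fun k => by simpa using hw k)
  refine ⟨(InnerProductSpace.toDual ℝ H).symm (WeakDual.toStrongDual f), φ, hφ, fun u => ?_⟩
  rw [real_inner_comm, InnerProductSpace.toDual_symm_apply]
  refine ((WeakDual.eval_continuous u).continuousAt.tendsto.comp hlim).congr fun k => ?_
  simp [real_inner_comm]

theorem ofReal_half_sq_norm_le_liminf {H : Type*} [NormedAddCommGroup H] [InnerProductSpace ℝ H]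
    {w : ℕ → H} {v : H} (hv : Tendsto (fun k => inner ℝ v (w k)) atTop (𝓝 (inner ℝ v v))) :
    ENNReal.ofReal (1 / 2 * ‖v‖ ^ 2) ≤
      liminf (fun k => ENNReal.ofReal (1 / 2 * ‖w k‖ ^ 2)) atTop := by
  have hlim : Tendsto (fun k => ENNReal.ofReal (inner ℝ v (w k) - 1 / 2 * ‖v‖ ^ 2)) atTop
      (𝓝 (ENNReal.ofReal (1 / 2 * ‖v‖ ^ 2))) := by
    convert ENNReal.tendsto_ofReal (hv.sub_const (1 / 2 * ‖v‖ ^ 2)) using 3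
    rw [real_inner_self_eq_norm_sq]
    ring
  rw [← hlim.liminf_eq]
  refine liminf_le_liminf (.of_forall fun k => ENNReal.ofReal_le_ofReal ?_)
  linarith [real_inner_le_norm v (w k), two_mul_le_add_sq ‖v‖ ‖w k‖]

theorem tendsto_of_tendsto_inner {E : Type*} [NormedAddCommGroup E] [InnerProductSpace ℝ E]
    [FiniteDimensional ℝ E] {ι : Type*} {l : Filter ι} {u : ι → E} {v : E}
    (h : ∀ c : E, Tendsto (fun k => inner ℝ c (u k)) l (𝓝 (inner ℝ c v))) :
    Tendsto u l (𝓝 v) := by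
  let e := stdOrthonormalBasis ℝ E
  rw [← e.sum_repr' v]
  exact Tendsto.congr (fun k => e.sum_repr' (u k))
    (tendsto_finsetSum _ fun i _ => (h (e i)).smul_const (e i))

variable {E : Type*} [NormedAddCommGroup E] [InnerProductSpace ℝ E]

theorem lintegral_half_sq_norm {X : Type*} [MeasurableSpace X] {μ : Measure X} (v : Lp E 2 μ) :
    ∫⁻ t, ENNReal.ofReal (1 / 2 * ‖v t‖ ^ 2) ∂μ = ENNReal.ofReal (1 / 2 * ‖v‖ ^ 2) := by
  have hint := (memLp_two_iff_integrable_sq_norm (Lp.memLp v).1).1 (Lp.memLp v)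
  rw [← ofReal_integral_eq_lintegral_ofReal (hint.const_mul _)
    (ae_of_all _ fun t => by positivity), integral_const_mul, ← real_inner_self_eq_norm_sq v,
    L2.inner_def]
  simp only [real_inner_self_eq_norm_sq]

theorem tendsto_setIntegral_of_tendsto_inner [FiniteDimensional ℝ E] {X : Type*}
    [MeasurableSpace X] {μ : Measure X} {w : ℕ → Lp E 2 μ} {v : Lp E 2 μ}
    (h : ∀ u, Tendsto (fun k => inner ℝ u (w k)) atTop (𝓝 (inner ℝ u v))) {s : Set X}
    (hs : MeasurableSet s) (hμs : μ s ≠ ⊤) :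
    Tendsto (fun k => ∫ t in s, w k t ∂μ) atTop (𝓝 (∫ t in s, v t ∂μ)) :=
  tendsto_of_tendsto_inner fun c => by
    simpa only [L2.inner_indicatorConstLp_eq_inner_setIntegral] using
      h (indicatorConstLp 2 hs hμs c)

end WeakCompactness

section RelaxedAction

variable {n : ℕ} {ξ ξm ξp : UnitSphere n} {Vmin T : ℝ} {p : (UnitSphere n → ℝ) × ℝ}
  {a b : ℝ} {x : ℝ → Space n} {v : Lp (Space n) 2 (volume : Measure ℝ)}

/-- The path issued from `ξ` at time `0` with square integrable velocity `v`. Velocities live on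
the whole line so that paths with different final times have velocities in the same space. -/
noncomputable def pathOfVelocity (ξ : UnitSphere n) (v : Lp (Space n) 2 (volume : Measure ℝ))
    (t : ℝ) : Space n :=
  ξ + ∫ s in (0 : ℝ)..t, v s

/-- The action on `[0, T]` of `pathOfVelocity ξ v`, but with the kinetic energy of `v` on the whole
line. -/
noncomputable def relaxedAction (p : (UnitSphere n → ℝ) × ℝ) (ξ : UnitSphere n) (T : ℝ)
    (v : Lp (Space n) 2 (volume : Measure ℝ)) : ℝ≥0∞ :=
  ENNReal.ofReal (1 / 2 * ‖v‖ ^ 2) +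
    ∫⁻ t in Ioo 0 T, singularPotential p (pathOfVelocity ξ v t)

theorem pathOfVelocity_zero : pathOfVelocity ξ v 0 = ξ := by
  rw [pathOfVelocity, intervalIntegral.integral_same, add_zero]

theorem intervalIntegrable_coeFn_Lp (v : Lp (Space n) 2 (volume : Measure ℝ)) (s t : ℝ) :
    IntervalIntegrable v volume s t :=
  ⟨((Lp.memLp v).restrict _).integrable one_le_two, ((Lp.memLp v).restrict _).integrable one_le_two⟩

theorem continuous_pathOfVelocity : Continuous (pathOfVelocity ξ v) :=
  continuous_const.add (intervalIntegral.continuous_primitive (intervalIntegrable_coeFn_Lp v) 0)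

theorem isAdmissible_pathOfVelocity (hT : 0 < T) (hv : pathOfVelocity ξm v T = ξp) :
    IsAdmissible ξm ξp 0 T (pathOfVelocity ξm v) :=
  ⟨hT, isH1_of_eq_integral hT.le ((Lp.memLp v).restrict _) fun _ _ => rfl,
    pathOfVelocity_zero, hv⟩

theorem action_eq_lintegral_add_lintegral :
    action p a b x = (∫⁻ t in Ioo a b, ENNReal.ofReal (1 / 2 * ‖deriv x t‖ ^ 2)) +
      ∫⁻ t in Ioo a b, singularPotential p (x t) :=
  lintegral_add_left (by have := (measurable_deriv x).norm; fun_prop) _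

theorem action_pathOfVelocity_le (hT : 0 ≤ T) :
    action p 0 T (pathOfVelocity ξ v) ≤ relaxedAction p ξ T v := by
  rw [action_eq_lintegral_add_lintegral, relaxedAction, ← lintegral_half_sq_norm]
  refine add_le_add_left (le_trans (le_of_eq (lintegral_congr_ae ?_))
    (setLIntegral_le_lintegral (Ioo 0 T) _)) _
  filter_upwards [ae_hasDerivAt_of_eq_integral hT (intervalIntegrable_coeFn_Lp v 0 T)
    fun t _ => (rfl : pathOfVelocity ξ v t = _)] with t ht
  rw [ht.deriv]

theorem tendsto_pathOfVelocity {w : ℕ → Lp (Space n) 2 (volume : Measure ℝ)}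
    (hw : ∀ u, Tendsto (fun k => inner ℝ u (w k)) atTop (𝓝 (inner ℝ u v))) {t : ℝ} (ht : 0 ≤ t) :
    Tendsto (fun k => pathOfVelocity ξ (w k) t) atTop (𝓝 (pathOfVelocity ξ v t)) := by
  simp only [pathOfVelocity, intervalIntegral.integral_of_le ht]
  exact (tendsto_setIntegral_of_tendsto_inner hw measurableSet_Ioc
    measure_Ioc_lt_top.ne).const_add _

theorem setLIntegral_Ioo_le_liminf {F : Space n → ℝ≥0∞} (hF : Continuous F) {τ : ℕ → ℝ}
    {y : ℕ → ℝ → Space n} {z : ℝ → Space n} (hy : ∀ k, Continuous (y k))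
    (hτ : Tendsto τ atTop (𝓝 T)) (hyz : ∀ t ∈ Ioo 0 T, Tendsto (fun k => y k t) atTop (𝓝 (z t))) :
    ∫⁻ t in Ioo 0 T, F (z t) ≤ liminf (fun k => ∫⁻ t in Ioo 0 (τ k), F (y k t)) atTop := by
  simp only [← lintegral_indicator measurableSet_Ioo]
  refine le_trans (lintegral_mono fun t => ?_) (lintegral_liminf_le fun k =>
    (hF.comp (hy k)).measurable.indicator measurableSet_Ioo)
  by_cases ht : t ∈ Ioo 0 T
  · rw [indicator_of_mem ht]
    refine (Tendsto.liminf_eq (((hF.tendsto _).comp (hyz t ht)).congr' ?_)).ge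
    filter_upwards [hτ.eventually_const_lt ht.2] with k hk
    rw [indicator_of_mem (show t ∈ Ioo 0 (τ k) from ⟨ht.1, hk⟩), Function.comp_apply]
  · rw [indicator_of_notMem ht]
    exact zero_le

theorem liminf_add_liminf_le_liminf_add {u w : ℕ → ℝ≥0∞} :
    liminf u atTop + liminf w atTop ≤ liminf (fun k => u k + w k) atTop := by
  simp only [liminf_eq_iSup_iInf_of_nat]
  rw [ENNReal.iSup_add_iSup_of_monotone]
  · exact iSup_mono fun m => le_iInf₂ fun k hk =>
      add_le_add (iInf₂_le k hk) (iInf₂_le k hk)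
  all_goals exact fun i j hij => biInf_mono fun k hk => hij.trans hk

theorem relaxedAction_le_liminf (hV : Continuous (singularPotential (n := n) p)) {τ : ℕ → ℝ}
    {w : ℕ → Lp (Space n) 2 (volume : Measure ℝ)} (hτ : Tendsto τ atTop (𝓝 T))
    (hw : ∀ u, Tendsto (fun k => inner ℝ u (w k)) atTop (𝓝 (inner ℝ u v))) :
    relaxedAction p ξ T v ≤ liminf (fun k => relaxedAction p ξ (τ k) (w k)) atTop :=
  (add_le_add (ofReal_half_sq_norm_le_liminf (hw v))
    (setLIntegral_Ioo_le_liminf hV (fun k => continuous_pathOfVelocity (ξ := ξ) (v := w k)) hτ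
      fun _ ht => tendsto_pathOfVelocity hw ht.1.le)).trans liminf_add_liminf_le_liminf_add

theorem pathOfVelocity_eq_of_tendsto {τ : ℕ → ℝ} {w : ℕ → Lp (Space n) 2 (volume : Measure ℝ)}
    {η : Space n} (hT : 0 ≤ T) (hτ : Tendsto τ atTop (𝓝 T))
    (hw : ∀ u, Tendsto (fun k => inner ℝ u (w k)) atTop (𝓝 (inner ℝ u v)))
    (hη : ∀ k t, τ k ≤ t → pathOfVelocity ξ (w k) t = η) : pathOfVelocity ξ v T = η := by
  have hafter (t : ℝ) (ht : T < t) : pathOfVelocity ξ v t = η := by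
    refine tendsto_nhds_unique (tendsto_pathOfVelocity hw (hT.trans ht.le))
      (tendsto_const_nhds.congr' ?_)
    filter_upwards [hτ.eventually_lt_const ht] with k hk using (hη k t hk.le).symm
  refine tendsto_nhds_unique
    ((continuous_pathOfVelocity.tendsto T).mono_left (nhdsWithin_le_nhds (s := Ioi T)))
    (tendsto_const_nhds.congr' ?_)
  filter_upwards [self_mem_nhdsWithin] with t ht using (hafter t ht).symm

theorem IsH1.exists_velocity (hx : IsH1 a b x) :
    ∃ v : Lp (Space n) 2 (volume : Measure ℝ),
      v =ᵐ[volume] (Ioc 0 (b - a)).indicator fun t => deriv x (a + t) := by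
  have hmp := (measurePreserving_add_left volume a).restrict_preimage
    (measurableSet_Ioc (a := a) (b := b))
  rw [preimage_const_add_Ioc, sub_self] at hmp
  have hderiv := hx.2
  rw [restrict_Ioo_eq_restrict_Ioc] at hderiv
  exact ⟨_, ((memLp_indicator_iff_restrict measurableSet_Ioc).2
    (hderiv.comp_measurePreserving hmp)).coeFn_toLp⟩

theorem pathOfVelocity_eq (hx : IsH1 a b x) (hab : a ≤ b) (hξ : x a = ξ)
    (hv : v =ᵐ[volume] (Ioc 0 (b - a)).indicator fun t => deriv x (a + t)) {t : ℝ} (ht : 0 ≤ t) :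
    pathOfVelocity ξ v t = x (a + min t (b - a)) := by
  have hmin : 0 ≤ min t (b - a) := le_min ht (sub_nonneg.2 hab)
  rw [pathOfVelocity, intervalIntegral.integral_of_le ht, integral_congr_ae (ae_restrict_of_ae hv),
    setIntegral_indicator measurableSet_Ioc, Ioc_inter_Ioc, sup_idem,
    ← intervalIntegral.integral_of_le hmin,
    intervalIntegral.integral_comp_add_left (fun s => deriv x s) a, add_zero, ← hξ]
  exact (hx.eq_add_integral_deriv ⟨le_add_of_nonneg_right hmin, by
    linarith [min_le_right t (b - a)]⟩).symm

theorem relaxedAction_eq_action (hx : IsH1 a b x) (hab : a ≤ b) (hξ : x a = ξ)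
    (hv : v =ᵐ[volume] (Ioc 0 (b - a)).indicator fun t => deriv x (a + t)) :
    relaxedAction p ξ (b - a) v = action p a b x := by
  have htranslate (f : ℝ → ℝ≥0∞) : ∫⁻ t in Ioo a b, f t = ∫⁻ t in Ioo 0 (b - a), f (a + t) := by
    rw [← (measurePreserving_add_left volume a).setLIntegral_comp_preimage_emb
      (measurableEmbedding_addLeft a), preimage_const_add_Ioo, sub_self]
  rw [relaxedAction, action_eq_lintegral_add_lintegral, htranslate, htranslate,
    ← lintegral_half_sq_norm]
  congr 1
  · rw [restrict_Ioo_eq_restrict_Ioc, ← lintegral_indicator measurableSet_Ioc]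
    refine lintegral_congr_ae ?_
    filter_upwards [hv] with t ht
    by_cases htmem : t ∈ Ioc 0 (b - a) <;> simp [ht, htmem]
  · refine setLIntegral_congr_fun measurableSet_Ioo fun t ht => ?_
    rw [pathOfVelocity_eq hx hab hξ hv ht.1.le, min_eq_left ht.2.le]

theorem IsAdmissible.exists_pathOfVelocity (hx : IsAdmissible ξm ξp a b x) :
    ∃ v : Lp (Space n) 2 (volume : Measure ℝ),
      (∀ t, b - a ≤ t → pathOfVelocity ξm v t = ξp) ∧
        relaxedAction p ξm (b - a) v = action p a b x := by
  obtain ⟨v, hv⟩ := hx.isH1.exists_velocity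
  refine ⟨v, fun t ht => ?_, relaxedAction_eq_action hx.isH1 hx.lt.le hx.left hv⟩
  rw [pathOfVelocity_eq hx.isH1 hx.lt.le hx.left hv ((sub_pos.2 hx.lt).le.trans ht),
    min_eq_right ht, add_sub_cancel, hx.right]

theorem norm_le_of_relaxedAction_le {A : ℝ≥0∞} (hA : A ≠ ⊤) (hv : relaxedAction p ξ T v ≤ A) :
    ‖v‖ ≤ √(2 * A.toReal) := by
  have hkin := (ENNReal.ofReal_le_iff_le_toReal hA).1 (le_self_add.trans hv)
  exact Real.le_sqrt_of_sq_le (by linarith)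

end RelaxedAction

section Existence

variable {n : ℕ} {ξm ξp : UnitSphere n} {Vmin : ℝ} {p : (UnitSphere n → ℝ) × ℝ} {a b : ℝ}
  {x : ℝ → Space n}

theorem level_le_action (hx : IsAdmissible ξm ξp a b x) : level ξm ξp p ≤ action p a b x :=
  sInf_le ⟨a, b, x, hx, rfl⟩

theorem ofReal_duration_mul_le_action (hV : 0 ≤ Vmin) (hmin : ∀ s, Vmin ≤ p.1 s) (hα : 0 ≤ p.2)
    {R : ℝ} (hR : 0 < R) (hxR : ∀ t ∈ Icc a b, ‖x t‖ ≤ R) :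
    ENNReal.ofReal (Vmin / R ^ p.2 * (b - a)) ≤ action p a b x := by
  have hpointwise (t : ℝ) (ht : t ∈ Ioo a b) : ENNReal.ofReal (Vmin / R ^ p.2) ≤
      ENNReal.ofReal (1 / 2 * ‖deriv x t‖ ^ 2) + singularPotential p (x t) := by
    refine le_add_left ?_
    by_cases hx0 : x t = 0
    · rw [hx0, singularPotential_zero]
      exact le_top
    rw [singularPotential_of_ne_zero hx0]
    refine ENNReal.ofReal_le_ofReal (le_trans ?_ (le_potential hmin hx0))
    have := norm_pos_iff.2 hx0
    have := hxR t (Ioo_subset_Icc_self ht)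
    gcongr
  calc ENNReal.ofReal (Vmin / R ^ p.2 * (b - a))
      = ∫⁻ _ in Ioo a b, ENNReal.ofReal (Vmin / R ^ p.2) := by
        rw [setLIntegral_const, Real.volume_Ioo, ENNReal.ofReal_mul (by positivity)]
    _ ≤ action p a b x := setLIntegral_mono' measurableSet_Ioo hpointwise

theorem exists_sub_le_of_action_le (hV : 0 < Vmin) (hmin : ∀ s, Vmin ≤ p.1 s) (hα0 : 0 ≤ p.2)
    (hα : p.2 < 2) {A : ℝ≥0∞} (hA : A ≠ ⊤) :
    ∃ C, ∀ (ξm ξp : UnitSphere n) (a b : ℝ) (x : ℝ → Space n),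
      IsAdmissible ξm ξp a b x → action p a b x ≤ A → b - a ≤ C := by
  obtain ⟨R, hR, hbound⟩ := exists_norm_le_of_action_le (n := n) hV hmin hα0 hα hA
  refine ⟨A.toReal / (Vmin / R ^ p.2), fun ξm ξp a b x hx hxA => ?_⟩
  rw [le_div_iff₀' (by positivity), ← ENNReal.ofReal_le_iff_le_toReal hA]
  exact (ofReal_duration_mul_le_action hV.le hmin hα0 hR (hbound ξm ξp a b x hx hxA)).trans hxA

theorem exists_minimizing_sequence (hlevel : level ξm ξp p ≠ ⊤) :
    ∃ (a b : ℕ → ℝ) (x : ℕ → ℝ → Space n),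
      (∀ k, IsAdmissible ξm ξp (a k) (b k) (x k)) ∧
      (∀ k, action p (a k) (b k) (x k) ≤ level ξm ξp p + 1) ∧
      Tendsto (fun k => action p (a k) (b k) (x k)) atTop (𝓝 (level ξm ξp p)) := by
  have hlt : level ξm ξp p < level ξm ξp p + 1 := ENNReal.lt_add_right hlevel one_ne_zero
  have hne := (sInf_lt_iff.1 hlt).imp fun _ => And.left
  obtain ⟨u, -, hu, hmem⟩ := exists_seq_tendsto_sInf hne (OrderBot.bddBelow _)
  obtain ⟨N, hN⟩ := eventually_atTop.1 (hu.eventually_lt_const hlt)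
  choose a b x hx hact using hmem
  refine ⟨fun k => a (k + N), fun k => b (k + N), fun k => x (k + N), fun k => hx _,
    fun k => ?_, ?_⟩
  · exact (hact (k + N)).symm.trans_le (hN _ (Nat.le_add_left N k)).le
  · exact (hu.comp (tendsto_add_atTop_nat N)).congr fun k => hact (k + N)

theorem exists_subseq_tendsto_velocity {A : ℝ≥0∞} {C : ℝ} (hA : A ≠ ⊤) {ξ : UnitSphere n}
    {τ : ℕ → ℝ} (hτ : ∀ k, τ k ∈ Icc 0 C) {w : ℕ → Lp (Space n) 2 (volume : Measure ℝ)}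
    (hw : ∀ k, relaxedAction p ξ (τ k) (w k) ≤ A) :
    ∃ T ≥ 0, ∃ (v : Lp (Space n) 2 (volume : Measure ℝ)) (φ : ℕ → ℕ), StrictMono φ ∧
      Tendsto (τ ∘ φ) atTop (𝓝 T) ∧
      ∀ u, Tendsto (fun k => inner ℝ u (w (φ k))) atTop (𝓝 (inner ℝ u v)) := by
  have : Fact ((2 : ℝ≥0∞) ≠ ⊤) := ⟨ENNReal.ofNat_ne_top⟩
  have : SecondCountableTopology (Lp (Space n) 2 (volume : Measure ℝ)) :=
    Lp.SecondCountableTopology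
  obtain ⟨T, hT, φ, hφ, hτφ⟩ := isCompact_Icc.tendsto_subseq hτ
  obtain ⟨v, ψ, hψ, hweak⟩ := exists_subseq_tendsto_inner (w := w ∘ φ)
    fun k => norm_le_of_relaxedAction_le hA (hw (φ k))
  exact ⟨T, hT.1, v, φ ∘ ψ, hφ.comp hψ, hτφ.comp hψ.tendsto_atTop, hweak⟩

theorem exists_achieves (hU : Continuous p.1) (hξ : ξp ≠ ξm) (hV : 0 < Vmin)
    (hmin : ∀ s, Vmin ≤ p.1 s) (hα0 : 0 < p.2) (hα : p.2 < 2) (hlevel : level ξm ξp p ≠ ⊤) :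
    ∃ (a b : ℝ) (x : ℝ → Space n), Achieves ξm ξp p a b x := by
  have hA : level ξm ξp p + 1 ≠ ⊤ := ENNReal.add_ne_top.2 ⟨hlevel, ENNReal.one_ne_top⟩
  obtain ⟨a, b, x, hadm, hact, hlim⟩ := exists_minimizing_sequence hlevel
  obtain ⟨C, hC⟩ := exists_sub_le_of_action_le (n := n) hV hmin hα0.le hα hA
  choose w hend hrelaxed using fun k => (hadm k).exists_pathOfVelocity (p := p)
  obtain ⟨T, hT0, v, φ, hφ, hτ, hweak⟩ := exists_subseq_tendsto_velocity hA (w := w)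
    (fun k => ⟨(sub_pos.2 (hadm k).lt).le, hC _ _ _ _ _ (hadm k) (hact k)⟩)
    fun k => (hrelaxed k).trans_le (hact k)
  have hv : pathOfVelocity ξm v T = ξp :=
    pathOfVelocity_eq_of_tendsto hT0 hτ hweak fun k => hend (φ k)
  have hT : 0 < T := hT0.lt_of_ne' fun hT => hξ (Subtype.ext (by
    rw [← hv, hT, pathOfVelocity_zero]))
  have hadmissible := isAdmissible_pathOfVelocity hT hv
  refine ⟨0, T, pathOfVelocity ξm v, hadmissible, le_antisymm ?_ (level_le_action hadmissible)⟩
  calc action p 0 T (pathOfVelocity ξm v) ≤ relaxedAction p ξm T v := action_pathOfVelocity_le hT0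
    _ ≤ liminf (fun k => relaxedAction p ξm (b (φ k) - a (φ k)) (w (φ k))) atTop :=
        relaxedAction_le_liminf (continuous_singularPotential hU hV hmin hα0) hτ hweak
    _ = level ξm ξp p := by
        simp only [hrelaxed]
        exact (hlim.comp hφ.tendsto_atTop).liminf_eq

end Existence

/-! ### Calculus of variations -/

theorem integrable_inner_of_memLp {X E : Type*} [MeasurableSpace X] {μ : Measure X}
    [NormedAddCommGroup E] [InnerProductSpace ℝ E] {f g : X → E} (hf : MemLp f 2 μ)
    (hg : MemLp g 2 μ) : Integrable (fun t => inner ℝ (f t) (g t)) μ :=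
  (L2.integrable_inner (𝕜 := ℝ) (hf.toLp f) (hg.toLp g)).congr <| by
    filter_upwards [hf.coeFn_toLp, hg.coeFn_toLp] with t hft hgt using by rw [hft, hgt]

theorem hasDerivAt_integral_half_sq_norm_add_smul {X E : Type*} [MeasurableSpace X]
    {μ : Measure X} [NormedAddCommGroup E] [InnerProductSpace ℝ E] {v w : X → E}
    (hv : MemLp v 2 μ) (hw : MemLp w 2 μ) :
    HasDerivAt (fun ε : ℝ => ∫ t, 1 / 2 * ‖v t + ε • w t‖ ^ 2 ∂μ)
      (∫ t, inner ℝ (v t) (w t) ∂μ) 0 := by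
  have hv2 : Integrable (fun t => 1 / 2 * ‖v t‖ ^ 2) μ := hv.norm.integrable_sq.const_mul _
  have hw2 : Integrable (fun t => 1 / 2 * ‖w t‖ ^ 2) μ := hw.norm.integrable_sq.const_mul _
  have hvw := integrable_inner_of_memLp hv hw
  have hexpand (ε : ℝ) : ∫ t, 1 / 2 * ‖v t + ε • w t‖ ^ 2 ∂μ = (∫ t, 1 / 2 * ‖v t‖ ^ 2 ∂μ) +
      ε * (∫ t, inner ℝ (v t) (w t) ∂μ) + ε ^ 2 * ∫ t, 1 / 2 * ‖w t‖ ^ 2 ∂μ := by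
    rw [← integral_const_mul, ← integral_const_mul, ← integral_add' hv2 (hvw.const_mul ε),
      ← integral_add' (hv2.add (hvw.const_mul ε)) (hw2.const_mul _)]
    refine integral_congr_ae (ae_of_all _ fun t => ?_)
    simp only [Pi.add_apply, norm_add_sq_real, norm_smul, inner_smul_right, mul_pow,
      Real.norm_eq_abs, sq_abs]
    ring
  simp only [hexpand]
  exact ((((hasDerivAt_id (0 : ℝ)).mul_const _).const_add _).add
    ((hasDerivAt_pow 2 (0 : ℝ)).mul_const _)).congr_deriv (by simp)

section Superposition

variable {X E G : Type*} [TopologicalSpace X] [NormedAddCommGroup E] [NormedSpace ℝ E]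
  [NormedAddCommGroup G] [NormedSpace ℝ G] {K : Set X} {Ω : Set E} {x φ : X → E}

theorem eventually_forall_add_smul_mem (hK : IsCompact K) (hΩ : IsOpen Ω)
    (hx : ContinuousOn x K) (hφ : ContinuousOn φ K) (hxΩ : MapsTo x K Ω) :
    ∀ᶠ ε in 𝓝 (0 : ℝ), ∀ t ∈ K, x t + ε • φ t ∈ Ω := by
  have := isCompact_iff_compactSpace.1 hK
  have hcont : Continuous fun q : ℝ × K => x q.2 + q.1 • φ q.2 := by
    have hxK := hx.comp_continuous continuous_subtype_val (Subtype.prop (p := (· ∈ K)))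
    have hφK := hφ.comp_continuous continuous_subtype_val (Subtype.prop (p := (· ∈ K)))
    exact (hxK.comp continuous_snd).add (continuous_fst.smul (hφK.comp continuous_snd))
  have h := isCompact_univ.eventually_forall_of_forall_eventually (x₀ := (0 : ℝ))
    (P := fun ε (t : K) => x t + ε • φ t ∈ Ω) fun t _ =>
      hcont.continuousAt.eventually_mem (hΩ.mem_nhds (by simpa using hxΩ t.2))
  simpa using h

theorem hasDerivAt_setIntegral_comp_add_smul [MeasurableSpace X] [OpensMeasurableSpace X]
    {μ : Measure X} [IsFiniteMeasureOnCompacts μ] (hK : IsCompact K) (hKm : MeasurableSet K)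
    {F : E → G} (hΩ : IsOpen Ω) (hF : ContDiffOn ℝ 1 F Ω)
    (hx : ContinuousOn x K) (hφ : ContinuousOn φ K) (hxΩ : MapsTo x K Ω) :
    HasDerivAt (fun ε : ℝ => ∫ t in K, F (x t + ε • φ t) ∂μ)
      (∫ t in K, fderiv ℝ F (x t) (φ t) ∂μ) 0 := by
  obtain ⟨r, hr, hmem⟩ := Metric.nhds_basis_closedBall.eventually_iff.1
    (eventually_forall_add_smul_mem hK hΩ hx hφ hxΩ)
  have hline (ε : ℝ) : ContinuousOn (fun t => x t + ε • φ t) K := hx.add (hφ.const_smul ε)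
  have hderiv : ContinuousOn (fun q : ℝ × X => fderiv ℝ F (x q.2 + q.1 • φ q.2) (φ q.2))
      (Metric.closedBall 0 r ×ˢ K) := by
    have hφ₂ : ContinuousOn (fun q : ℝ × X => φ q.2) (Metric.closedBall 0 r ×ˢ K) :=
      hφ.comp continuousOn_snd fun q hq => hq.2
    have hx₂ : ContinuousOn (fun q : ℝ × X => x q.2) (Metric.closedBall 0 r ×ˢ K) :=
      hx.comp continuousOn_snd fun q hq => hq.2
    exact ((hF.continuousOn_fderiv_of_isOpen hΩ le_rfl).comp
      (hx₂.add (continuousOn_fst.smul hφ₂)) fun q hq => hmem hq.1 _ hq.2).clm_apply hφ₂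
  obtain ⟨C, hC⟩ := ((isCompact_closedBall (0 : ℝ) r).prod hK).exists_bound_of_continuousOn hderiv
  have hzero : (0 : ℝ) ∈ Metric.closedBall 0 r := Metric.mem_closedBall_self hr.le
  have hint (ε : ℝ) (hε : ε ∈ Metric.closedBall 0 r) :
      IntegrableOn (fun t => F (x t + ε • φ t)) K μ :=
    (hF.continuousOn.comp (hline ε) (hmem hε)).integrableOn_compact' hK hKm
  have hdom := (hasDerivAt_integral_of_dominated_loc_of_deriv_le (μ := μ.restrict K)
    (F := fun ε t => F (x t + ε • φ t)) (F' := fun ε t => fderiv ℝ F (x t + ε • φ t) (φ t))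
    (bound := fun _ => C) (Metric.closedBall_mem_nhds 0 hr)
    (by filter_upwards [Metric.closedBall_mem_nhds (0 : ℝ) hr] with ε hε using (hint ε hε).1)
    (hint 0 hzero)
    ((hderiv.comp (f := fun t => ((0 : ℝ), t)) (by fun_prop) fun t ht =>
      ⟨hzero, ht⟩).integrableOn_compact' hK hKm).1
    (by filter_upwards [ae_restrict_mem hKm] with t ht ε hε using hC (ε, t) ⟨hε, ht⟩)
    (integrableOn_const hK.measure_lt_top.ne) ?_).2
  · simpa only [zero_smul, add_zero] using hdom
  · filter_upwards [ae_restrict_mem hKm] with t ht ε hε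
    exact ((hF.differentiableOn one_ne_zero).differentiableAt
      (hΩ.mem_nhds (hmem hε t ht))).hasFDerivAt.comp_hasDerivAt ε
      (by simpa using ((hasDerivAt_id ε).smul_const (φ t)).const_add (x t))

end Superposition

section DuBoisReymond

variable {E : Type*} [NormedAddCommGroup E] [InnerProductSpace ℝ E] {a b : ℝ}

theorem absolutelyContinuousOnInterval_inner {f g : ℝ → E}
    (hf : AbsolutelyContinuousOnInterval f a b) (hg : AbsolutelyContinuousOnInterval g a b) :
    AbsolutelyContinuousOnInterval (fun t => inner ℝ (f t) (g t)) a b := by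
  have hnorm {h : ℝ → E} (hh : AbsolutelyContinuousOnInterval h a b) :
      AbsolutelyContinuousOnInterval (fun t => ‖h t‖) a b :=
    absolutelyContinuousOnInterval_lipschitzWith_comp lipschitzWith_one_norm hh
  have hsq {h : ℝ → E} (hh : AbsolutelyContinuousOnInterval h a b) :=
    (hnorm hh).fun_mul (hnorm hh)
  convert (((hsq hf).fun_add (hsq hg)).fun_sub (hsq (hf.fun_sub hg))).const_mul (1 / 2) using 2
    with t
  rw [real_inner_eq_norm_mul_self_add_norm_mul_self_sub_norm_sub_mul_self_div_two]
  ring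

theorem intervalIntegrable_inner_of_continuousOn {f g : ℝ → E} (hf : ContinuousOn f (uIcc a b))
    (hg : IntervalIntegrable g volume a b) :
    IntervalIntegrable (fun t => inner ℝ (f t) (g t)) volume a b := by
  obtain ⟨C, hC⟩ := isCompact_uIcc.exists_bound_of_continuousOn hf
  rw [intervalIntegrable_iff] at hg ⊢
  refine Integrable.mono' (hg.norm.const_mul C)
    (((hf.mono uIoc_subset_uIcc).aestronglyMeasurable measurableSet_uIoc).inner hg.1) ?_
  filter_upwards [ae_restrict_mem measurableSet_uIoc] with t ht
  exact (norm_inner_le_norm _ _).trans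
    (mul_le_mul_of_nonneg_right (hC t (uIoc_subset_uIcc ht)) (norm_nonneg _))

theorem integral_inner_primitive_add_integral_primitive_inner [CompleteSpace E] {g w : ℝ → E}
    (hg : IntervalIntegrable g volume a b) (hw : IntervalIntegrable w volume a b) :
    (∫ t in a..b, inner ℝ (g t) (∫ s in a..t, w s)) +
        ∫ t in a..b, inner ℝ (∫ s in a..t, g s) (w t) =
      inner ℝ (∫ t in a..b, g t) (∫ t in a..b, w t) := by
  have hgac := absolutelyContinuousOnInterval_primitive hg
  have hwac := absolutelyContinuousOnInterval_primitive hw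
  have hderiv : ∀ᵐ t, t ∈ uIoc a b →
      deriv (fun t => inner ℝ (∫ s in a..t, g s) (∫ s in a..t, w s)) t =
        inner ℝ (∫ s in a..t, g s) (w t) + inner ℝ (g t) (∫ s in a..t, w s) := by
    filter_upwards [hg.ae_hasDerivAt_integral, hw.ae_hasDerivAt_integral] with t hgt hwt ht
    have ht' := uIoc_subset_uIcc ht
    exact ((hgt ht' a left_mem_uIcc).inner ℝ (hwt ht' a left_mem_uIcc)).deriv
  have hright := intervalIntegrable_inner_of_continuousOn hwac.continuousOn hg
  simp only [real_inner_comm] at hright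
  have hftc := (absolutelyContinuousOnInterval_inner hgac hwac).integral_deriv_eq_sub
  rw [intervalIntegral.integral_congr_ae hderiv, intervalIntegral.integral_add
    (intervalIntegrable_inner_of_continuousOn hgac.continuousOn hw) hright] at hftc
  simpa [add_comm] using hftc

theorem ae_eq_average_of_forall_integral_inner_eq_zero [CompleteSpace E] {X : Type*}
    [MeasurableSpace X] {μ : Measure X} [IsFiniteMeasure μ] {u : X → E} (hu : MemLp u 2 μ)
    (h : ∀ w : X → E, MemLp w 2 μ → ∫ t, w t ∂μ = 0 → ∫ t, inner ℝ (u t) (w t) ∂μ = 0) :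
    u =ᵐ[μ] fun _ => ⨍ t, u t ∂μ := by
  set m := ⨍ t, u t ∂μ
  have hw : MemLp (fun t => u t - m) 2 μ := hu.sub (memLp_const m)
  have hw0 : ∫ t, (u t - m) ∂μ = 0 := integral_sub_average μ u
  have hm : ∫ t, inner ℝ m (u t - m) ∂μ = 0 := by
    rw [integral_inner (hw.integrable one_le_two), hw0, inner_zero_right]
  have hsq : ∫ t, ‖u t - m‖ ^ 2 ∂μ = 0 := by
    simp only [← real_inner_self_eq_norm_sq, inner_sub_left]
    rw [integral_sub (integrable_inner_of_memLp hu hw)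
      (integrable_inner_of_memLp (memLp_const m) hw), h _ hw hw0, hm, sub_zero]
  filter_upwards [(integral_eq_zero_iff_of_nonneg (fun t => by positivity)
    hw.norm.integrable_sq).1 hsq] with t ht
  simpa [sub_eq_zero] using ht

theorem exists_ae_eq_primitive_add_const [CompleteSpace E] (hab : a ≤ b) {v g : ℝ → E}
    (hv : MemLp v 2 (volume.restrict (Ioo a b))) (hg : IntervalIntegrable g volume a b)
    (h : ∀ w : ℝ → E, MemLp w 2 (volume.restrict (Ioo a b)) → ∫ t in a..b, w t = 0 →
      (∫ t in Ioo a b, inner ℝ (v t) (w t)) +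
        ∫ t in Ioo a b, inner ℝ (g t) (∫ s in a..t, w s) = 0) :
    ∃ m : E, ∀ᵐ t ∂volume.restrict (Ioo a b), v t = (∫ s in a..t, g s) + m := by
  have hG : MemLp (fun t => ∫ s in a..t, g s) 2 (volume.restrict (Ioo a b)) := by
    have hcont := (absolutelyContinuousOnInterval_primitive hg).continuousOn
    rw [uIcc_of_le hab] at hcont
    obtain ⟨C, hC⟩ := isCompact_Icc.exists_bound_of_continuousOn hcont
    refine .of_bound ((hcont.mono Ioo_subset_Icc_self).aestronglyMeasurable measurableSet_Ioo) C ?_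
    filter_upwards [ae_restrict_mem measurableSet_Ioo] with t ht using hC t (Ioo_subset_Icc_self ht)
  have hae := ae_eq_average_of_forall_integral_inner_eq_zero (hv.sub hG) fun w hw hw0 => by
    rw [← integral_Ioc_eq_integral_Ioo, ← intervalIntegral.integral_of_le hab] at hw0
    have hparts := integral_inner_primitive_add_integral_primitive_inner hg
      (intervalIntegrable_of_memLp_Ioo one_le_two hw hab)
    rw [hw0, inner_zero_right] at hparts
    simp only [intervalIntegral.integral_of_le hab, integral_Ioc_eq_integral_Ioo] at hparts
    simp only [Pi.sub_apply, inner_sub_left]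
    rw [integral_sub (integrable_inner_of_memLp hv hw) (integrable_inner_of_memLp hG hw)]
    linarith [h w hw hw0]
  exact ⟨_, hae.mono fun t ht => eq_add_of_sub_eq' ht⟩

end DuBoisReymond

/-! ### The Euler–Lagrange equation -/

section EulerLagrange

theorem hasDerivAt_primitive_of_continuousOn {E : Type*} [NormedAddCommGroup E]
    [NormedSpace ℝ E] [CompleteSpace E] {a b : ℝ} {f : ℝ → E} (hf : ContinuousOn f (Icc a b))
    {t : ℝ} (ht : t ∈ Ioo a b) : HasDerivAt (fun s => ∫ r in a..s, f r) (f t) t :=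
  intervalIntegral.integral_hasDerivAt_right
    ((hf.mono (Icc_subset_Icc_right ht.2.le)).intervalIntegrable_of_Icc ht.1.le)
    ((hf.mono Ioo_subset_Icc_self).stronglyMeasurableAtFilter isOpen_Ioo t ht)
    (hf.continuousAt (Icc_mem_nhds ht.1 ht.2))

variable {n : ℕ} {ξm ξp : UnitSphere n} {p : (UnitSphere n → ℝ) × ℝ} {a b : ℝ}
  {x w : ℝ → Space n}

theorem continuousOn_gradient_potential_comp (hU : ContMDiff (𝓡 n) 𝓘(ℝ, ℝ) 1 p.1) {s : Set ℝ}
    (hx : ContinuousOn x s) (hne : ∀ t ∈ s, x t ≠ 0) :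
    ContinuousOn (fun t => gradient (potential p) (x t)) s := fun t ht =>
  (continuousAt_gradient_potential hU (hne t ht)).comp_continuousWithinAt (hx t ht)

theorem integrableOn_potential_comp (hU : Continuous p.1) (hx : ContinuousOn x (Icc a b))
    (hne : ∀ t ∈ Icc a b, x t ≠ 0) : IntegrableOn (fun t => potential p (x t)) (Icc a b) :=
  ContinuousOn.integrableOn_Icc fun t ht =>
    (contDiffAt_potential (contMDiff_zero_iff.2 hU) (hne t ht)).continuousAt.comp_continuousWithinAt
      (hx t ht)

theorem action_eq_ofReal_integral (hU : Continuous p.1) (hp : ∀ s, 0 ≤ p.1 s)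
    (hx : ContinuousOn x (Icc a b)) (hne : ∀ t ∈ Icc a b, x t ≠ 0) {v : ℝ → Space n}
    (hv : MemLp v 2 (volume.restrict (Ioo a b)))
    (hxv : ∀ᵐ t ∂volume.restrict (Ioo a b), HasDerivAt x (v t) t) :
    action p a b x = ENNReal.ofReal
      ((∫ t in Ioo a b, 1 / 2 * ‖v t‖ ^ 2) + ∫ t in Ioo a b, potential p (x t)) := by
  have hpot := (integrableOn_potential_comp hU hx hne).mono_set Ioo_subset_Icc_self
  rw [action_eq_lintegral_add_lintegral, ENNReal.ofReal_add
    (integral_nonneg fun t => by positivity) (integral_nonneg fun t => potential_nonneg hp _),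
    ofReal_integral_eq_lintegral_ofReal (hv.norm.integrable_sq.const_mul _)
      (ae_of_all _ fun t => by positivity),
    ofReal_integral_eq_lintegral_ofReal hpot (ae_of_all _ fun t => potential_nonneg hp _)]
  congr 1
  · refine lintegral_congr_ae ?_
    filter_upwards [hxv] with t ht
    rw [ht.deriv]
  · refine setLIntegral_congr_fun measurableSet_Ioo fun t ht => ?_
    exact singularPotential_of_ne_zero (hne t (Ioo_subset_Icc_self ht))

theorem IsH1.add_smul_primitive_eq (hx : IsH1 a b x) (hw : IntervalIntegrable w volume a b)
    (ε : ℝ) {t : ℝ} (ht : t ∈ Icc a b) :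
    x t + ε • (∫ s in a..t, w s) = x a + ∫ s in a..t, (deriv x s + ε • w s) := by
  have hwt : IntervalIntegrable w volume a t := hw.mono_set
    (uIcc_subset_uIcc left_mem_uIcc (Icc_subset_uIcc ht))
  have hεw : IntervalIntegrable (fun s => ε • w s) volume a t := hwt.smul ε
  rw [intervalIntegral.integral_add ((hx.mono le_rfl ht.1 ht.2).intervalIntegrable_deriv ht.1) hεw,
    intervalIntegral.integral_smul, ← add_assoc, ← hx.eq_add_integral_deriv ht]

theorem IsAdmissible.add_smul_primitive (hx : IsAdmissible ξm ξp a b x)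
    (hw : MemLp w 2 (volume.restrict (Ioo a b))) (hw0 : ∫ t in a..b, w t = 0) (ε : ℝ) :
    IsAdmissible ξm ξp a b fun t => x t + ε • ∫ s in a..t, w s where
  lt := hx.lt
  isH1 := isH1_of_eq_integral hx.lt.le (hx.isH1.2.add (hw.const_smul ε)) fun _ ht =>
    hx.isH1.add_smul_primitive_eq (intervalIntegrable_of_memLp_Ioo one_le_two hw hx.lt.le) ε ht
  left := by rw [intervalIntegral.integral_same, smul_zero, add_zero, hx.left]
  right := by rw [hw0, smul_zero, add_zero, hx.right]

theorem Achieves.first_variation (hU : ContMDiff (𝓡 n) 𝓘(ℝ, ℝ) 1 p.1) (hp : ∀ s, 0 ≤ p.1 s)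
    (hx : Achieves ξm ξp p a b x) (hne : ∀ t ∈ Icc a b, x t ≠ 0)
    (hw : MemLp w 2 (volume.restrict (Ioo a b))) (hw0 : ∫ t in a..b, w t = 0) :
    (∫ t in Ioo a b, inner ℝ (deriv x t) (w t)) +
      ∫ t in Ioo a b, inner ℝ (gradient (potential p) (x t)) (∫ s in a..t, w s) = 0 := by
  obtain ⟨hadm, hact⟩ := hx
  have hab := hadm.lt.le
  have hxc := hadm.isH1.continuousOn hab
  have hwI := intervalIntegrable_of_memLp_Ioo one_le_two hw hab
  have hφc : ContinuousOn (fun t => ∫ s in a..t, w s) (Icc a b) := by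
    simpa only [uIcc_of_le hab] using (absolutelyContinuousOnInterval_primitive hwI).continuousOn
  let J : ℝ → ℝ := fun ε => (∫ t in Ioo a b, 1 / 2 * ‖deriv x t + ε • w t‖ ^ 2) +
    ∫ t in Ioo a b, potential p (x t + ε • ∫ s in a..t, w s)
  have hJ0 (ε : ℝ) : 0 ≤ J ε := add_nonneg (integral_nonneg fun t => by positivity)
    (integral_nonneg fun t => potential_nonneg hp _)
  have haction : ∀ᶠ ε in 𝓝 (0 : ℝ),
      action p a b (fun t => x t + ε • ∫ s in a..t, w s) = ENNReal.ofReal (J ε) := by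
    filter_upwards [eventually_forall_add_smul_mem isCompact_Icc isOpen_compl_singleton hxc hφc hne]
      with ε hε
    have hv := hadm.isH1.2.add (hw.const_smul ε)
    exact action_eq_ofReal_integral hU.continuous hp (hxc.add (hφc.const_smul ε)) hε hv
      (ae_hasDerivAt_of_eq_integral hab (intervalIntegrable_of_memLp_Ioo one_le_two hv hab)
        fun t ht => hadm.isH1.add_smul_primitive_eq hwI ε ht)
  have hmin : IsLocalMin J 0 := by
    have hlevel : level ξm ξp p = ENNReal.ofReal (J 0) := by
      simpa only [zero_smul, add_zero, hact] using haction.self_of_nhds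
    filter_upwards [haction] with ε hε
    rw [← ENNReal.ofReal_le_ofReal_iff (hJ0 ε), ← hε, ← hlevel]
    exact level_le_action (hadm.add_smul_primitive hw hw0 ε)
  have hpot := hasDerivAt_setIntegral_comp_add_smul (μ := volume) isCompact_Icc measurableSet_Icc
    isOpen_compl_singleton (fun y hy => (contDiffAt_potential hU hy).contDiffWithinAt) hxc hφc hne
  simp only [← inner_gradient_left, ← restrict_Ioo_eq_restrict_Icc] at hpot
  exact hmin.hasDerivAt_eq_zero
    ((hasDerivAt_integral_half_sq_norm_add_smul hadm.isH1.2 hw).add hpot)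

theorem Achieves.exists_ae_deriv_eq (hU : ContMDiff (𝓡 n) 𝓘(ℝ, ℝ) 1 p.1) (hp : ∀ s, 0 ≤ p.1 s)
    (hx : Achieves ξm ξp p a b x) (hne : ∀ t ∈ Icc a b, x t ≠ 0) :
    ∃ m : Space n, ∀ᵐ t ∂volume.restrict (Ioo a b),
      deriv x t = (∫ s in a..t, gradient (potential p) (x s)) + m :=
  exists_ae_eq_primitive_add_const hx.1.lt.le hx.1.isH1.2
    ((continuousOn_gradient_potential_comp hU (hx.1.isH1.continuousOn hx.1.lt.le)
      hne).intervalIntegrable_of_Icc hx.1.lt.le)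
    fun _ => hx.first_variation hU hp hne

theorem Achieves.isSolution (hU : ContMDiff (𝓡 n) 𝓘(ℝ, ℝ) 1 p.1) (hp : ∀ s, 0 ≤ p.1 s)
    (hx : Achieves ξm ξp p a b x) (hne : ∀ t ∈ Icc a b, x t ≠ 0) : IsSolution p a b x := by
  obtain ⟨m, hm⟩ := hx.exists_ae_deriv_eq hU hp hne
  have hH1 := hx.1.isH1
  have hgrad := continuousOn_gradient_potential_comp hU (hH1.continuousOn hx.1.lt.le) hne
  set v : ℝ → Space n := fun t => (∫ s in a..t, gradient (potential p) (x s)) + m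
  have hv : ContinuousOn v (Icc a b) := by
    have hprim := absolutelyContinuousOnInterval_primitive
      (hgrad.intervalIntegrable_of_Icc hx.1.lt.le)
    exact (uIcc_of_le hx.1.lt.le ▸ hprim.continuousOn).add continuousOn_const
  have hderiv (t : ℝ) (ht : t ∈ Ioo a b) : HasDerivAt x (v t) t := by
    refine ((hasDerivAt_primitive_of_continuousOn hv ht).const_add (x a)).congr_of_eventuallyEq ?_
    filter_upwards [isOpen_Ioo.mem_nhds ht] with s hs
    rw [hH1.eq_add_integral_deriv (Ioo_subset_Icc_self hs)]
    congr 1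
    refine intervalIntegral.integral_congr_ae_restrict ?_
    rw [uIoc_of_le hs.1.le, ← restrict_Ioo_eq_restrict_Ioc]
    exact ae_restrict_of_ae_restrict_of_subset (Ioo_subset_Ioo_right hs.2.le) hm
  refine fun t ht => ⟨hne t (Ioo_subset_Icc_self ht), (hderiv t ht).differentiableAt, ?_⟩
  refine ((hasDerivAt_primitive_of_continuousOn hgrad ht).add_const m).congr_of_eventuallyEq ?_
  filter_upwards [isOpen_Ioo.mem_nhds ht] with s hs using (hderiv s hs).deriv

end EulerLagrange

end AnisotropicKepler

theorem mainTheorem4_general {n : ℕ} {ξm ξp : AnisotropicKepler.UnitSphere n} (hξ : ξp ≠ ξm)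
    {Vmin : ℝ} (hVmin : 0 < Vmin) {V : (AnisotropicKepler.UnitSphere n → ℝ) × ℝ}
    (hU : ContMDiff (𝓡 n) 𝓘(ℝ, ℝ) 1 V.1) (hξm : V.1 ξm = Vmin) (hξp : V.1 ξp = Vmin)
    (hmin : ∀ s, Vmin ≤ V.1 s) (hα : V.2 ∈ Set.Ioo (0 : ℝ) 2) :
    (∃ (a b : ℝ) (x : ℝ → AnisotropicKepler.Space n),
      AnisotropicKepler.Achieves ξm ξp V a b x) ∧
    Xor
      (AnisotropicKepler.level ξm ξp V = ENNReal.ofReal (4 * √(2 * Vmin) / (2 - V.2)) ∧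
        ∃ (a b : ℝ) (x : ℝ → AnisotropicKepler.Space n),
          AnisotropicKepler.Achieves ξm ξp V a b x ∧
            AnisotropicKepler.IsDoubleHomothetic ξm ξp V a b x)
      (AnisotropicKepler.level ξm ξp V < ENNReal.ofReal (4 * √(2 * Vmin) / (2 - V.2)) ∧
        ∃ ρ : ℝ, 0 < ρ ∧ ∀ (a b : ℝ) (x : ℝ → AnisotropicKepler.Space n),
          AnisotropicKepler.Achieves ξm ξp V a b x →
            AnisotropicKepler.IsSolution V a b x ∧ ∀ t ∈ Set.Icc a b, ρ ≤ ‖x t‖) := by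
  open AnisotropicKepler in
  obtain ⟨hα0, hα2⟩ := hα
  have hadm := isAdmissible_collisionPath hVmin hα0 hα2 hξm hξp
  have haction := action_collisionPath hVmin hα0 hα2 hξm hξp
  have hle := (level_le_action hadm).trans_eq haction
  refine ⟨exists_achieves hU.continuous hξ hVmin hmin hα0 hα2
    (hle.trans_lt ENNReal.ofReal_lt_top).ne, ?_⟩
  rw [← two_mul_radialCost_one]
  rcases hle.eq_or_lt with heq | hlt
  · exact Or.inl ⟨⟨heq, _, _, _, ⟨hadm, haction.trans heq.symm⟩,
      isDoubleHomothetic_collisionPath hU hVmin hα0 hξm hξp hmin⟩, fun h => h.1.ne heq⟩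
  · obtain ⟨ρ, hρ, hfar⟩ := exists_le_norm_of_action_le hVmin hmin hα0.le hα2 hlt
    refine Or.inr ⟨⟨hlt, ρ, hρ, fun a b x hx => ?_⟩, fun h => hlt.ne h.1⟩
    have hρx := hfar _ _ _ _ _ hx.1 hx.2.le
    exact ⟨hx.isSolution hU (fun s => hVmin.le.trans (hmin s)) fun t ht =>
      norm_pos_iff.1 (hρ.trans_le (hρx t ht)), hρx⟩

theorem mainTheorem4 {n : ℕ} (hn : 1 ≤ n) (ξm ξp : AnisotropicKepler.UnitSphere n) (hξ : ξp ≠ ξm)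
    (Vmin : ℝ) (hVmin : 0 < Vmin) (V : (AnisotropicKepler.UnitSphere n → ℝ) × ℝ)
    (hV : V ∈ AnisotropicKepler.classP ξm ξp Vmin) :
    (∃ (a b : ℝ) (x : ℝ → AnisotropicKepler.Space n),
      AnisotropicKepler.Achieves ξm ξp V a b x) ∧
    Xor
      (AnisotropicKepler.level ξm ξp V = ENNReal.ofReal (4 * √(2 * Vmin) / (2 - V.2)) ∧
        ∃ (a b : ℝ) (x : ℝ → AnisotropicKepler.Space n),
          AnisotropicKepler.Achieves ξm ξp V a b x ∧
            AnisotropicKepler.IsDoubleHomothetic ξm ξp V a b x)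
      (AnisotropicKepler.level ξm ξp V < ENNReal.ofReal (4 * √(2 * Vmin) / (2 - V.2)) ∧
        ∃ ρ : ℝ, 0 < ρ ∧ ∀ (a b : ℝ) (x : ℝ → AnisotropicKepler.Space n),
          AnisotropicKepler.Achieves ξm ξp V a b x →
            AnisotropicKepler.IsSolution V a b x ∧ ∀ t ∈ Set.Icc a b, ρ ≤ ‖x t‖) := by
  have hS := hV.1
  exact mainTheorem4_general hξ hVmin (hS.contMDiff.of_le one_le_two) hS.eq_left hS.eq_right
    hS.min_le hV.2
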